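/- Let $d\ge 1$, let $\Omega\subset\mathbb{R}^d$ be a bounded open set, $T>0$, $Q=\Omega\times(0,T]$, and let $\mathbf g\in\mathbb{R}^d$ be a constant vector. Let $(\cdot,\cdot)$ and $\|\cdot\|$ be the inner product and norm of $L^2(\Omega)$, let $H^1_0(\Omega)$ be the closure of $C_c^\infty(\Omega)$ in $H^1(\Omega)$, with dual $H^{-1}(\Omega)$ and duality pairing $\langle\cdot,\cdot\rangle$, and let $\mathcal W=\{u\in L^2(0,T;H^1_0(\Omega)) : \partial_t u\in L^2(0,T;H^{-1}(\Omega))\}$, whose elements are continuous in time with values in $L^2(\Omega)$. Assume the following. 1. $p^{(i)}_c,p^{(d)}_c:(0,1]\to\mathbb{R}$ are continuous, of class $C^1$ on $(0,1)$ with ${p^{(i)}_c}',{p^{(d)}_c}'<0$ and $p^{(d)}_c>p^{(i)}_c$ on $(0,1)$, $p^{(i)}_c(1)=p^{(d)}_c(1)$, and $p^{(j)}_c(S)\to\infty$ as $S\searrow0$, $-{p^{(j)}_c}'(S)\to\infty$ as $S\nearrow 1$ for $j\in\{i,d\}$. 2. $k\in C^1(\mathbb{R})$, $k(S)=k(0)\ge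 0$ for $S\le 0$, $k(S)=k(1)$ for $S\ge 1$, and $k(0)<k(S)<k(1)$ for $0<S<1$. Moreover $k(0)>0$ or $\mathbf g=0$. 3. $b\in C^1(\mathbb{R})$, $b(0)=0$, $b'\ge 0$ on $\mathbb{R}$, $\sup_{\mathbb{R}}b'<\infty$, and $0<b'(p^{(j)}_c(S))<-1/{p^{(j)}_c}'(S)$ for all $0<S<1$ and $j\in\{i,d\}$. 4. $S_0\in H^1(\Omega)$, $p_0\in H^1_0(\Omega)$, and there is $\epsilon>0$ with $\epsilon\le S_0\le 1-\epsilon$ and $p^{(i)}_c(S_0)\le p_0\le p^{(d)}_c(S_0)$ a.e. in $\Omega$. Put $U_M=V_m=\lim_{p\to\infty}b(p)$ (a finite limit), $U_m=b(p^{(i)}_c(1))$, $V_M=1+U_m$. For $j\in\{i,d\}$ and $V_m<v<V_M$ let $\rho^{(j)}(v)=b(p^{(j)}_c(S))$, where $S\in(0,1)$ is the unique solution of $S+b(p^{(j)}_c(S))=v$; let $\rho^{(j)}(v)=U_M$ for $v\le V_m$ and $\rho^{(j)}(v)=U_m$ for $v\ge V_M$. For $\tau>0$ let $$\Phi_\tau(u,v)=\frac1\tau\begin{cases}\rho^{(d)}(v)-u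 & \text{if } u>\rho^{(d)}(v),\\ 0 & \text{if } \rho^{(i)}(v)\le u\le\rho^{(d)}(v),\\ \rho^{(i)}(v)-u & \text{if } u<\rho^{(i)}(v).\end{cases}$$ A weak solution for the parameter $\tau$ is a pair $(S,p)$ with $p\in\mathcal W$, $S-S_0\in\mathcal W$, $S\in[0,1]$ a.e. in $Q$, $p(0)=p_0$, $S(0)=S_0$, $\partial_t(S+b(p))\in L^2(Q)$, and $$\int_0^T\langle\partial_tS,\phi\rangle=\int_0^T(k(S)[\nabla p-\mathbf g],\nabla\phi),\qquad \int_0^T(\partial_t(S+b(p)),\xi)=\int_0^T(\Phi_\tau(b(p),S+b(p)),\xi)$$ for all $\phi\in L^2(0,T;H^1_0(\Omega))$ and $\xi\in L^2(Q)$. Then: (i) There is a constant $C$ such that for every $\tau>0$ and every weak solution $(S_\tau,p_\tau)$ for $\tau$, the function $u_\tau:=b(p_\tau)$ lies in $L^2(0,T;H^1_0(\Omega))\cap L^\infty(0,T;L^2(\Omega))$ with $\|u_\tau\|_{L^2(0,T;H^1_0(\Omega))}\le C$ and $\|u_\tau\|_{L^\infty(0,T;L^2(\Omega))}\le C$. (ii)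 For every sequence $\tau_n>0$ with $\tau_n\to0$ and all weak solutions $(S_{\tau_n},p_{\tau_n})$ for $\tau_n$, there are a subsequence $(\tau_{n_m})_m$ and $u\in L^2(0,T;H^1_0(\Omega))\cap L^\infty(0,T;L^2(\Omega))$ such that $u_{\tau_{n_m}}=b(p_{\tau_{n_m}})\rightharpoonup u$ weakly in $L^2(0,T;H^1_0(\Omega))$ as $m\to\infty$. -/

import Mathlib

open MeasureTheory Filter Set
open scoped Topology ENNReal ContDiff

noncomputable section

/-! ### Function spaces on a bounded open set of `ℝ^d` and on the time interval `(0, T)` -/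

/-- Euclidean space `ℝ^d`. -/
abbrev EPHSpace (d : ℕ) : Type := EuclideanSpace ℝ (Fin d)

/-- `L²(Ω)`. -/
abbrev EPHL2 {d : ℕ} (Ω : Set (EPHSpace d)) : Type := Lp ℝ 2 (volume.restrict Ω)

/-- `L²(Ω; ℝ^d)`. -/
abbrev EPHL2Vec {d : ℕ} (Ω : Set (EPHSpace d)) : Type :=
  Lp (EPHSpace d) 2 (volume.restrict Ω)

/-- The Hilbert space `L²(Ω) × L²(Ω; ℝ^d)` of pairs (function, gradient field),
with the norm `(‖f‖² + ‖G‖²)^{1/2}`. -/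
abbrev EPHPair {d : ℕ} (Ω : Set (EPHSpace d)) : Type := WithLp 2 (EPHL2 Ω × EPHL2Vec Ω)

/-- Test functions `C_c^∞(Ω)`. -/
def IsTestFunction {d : ℕ} (Ω : Set (EPHSpace d)) (φ : EPHSpace d → ℝ) : Prop :=
  ContDiff ℝ ∞ φ ∧ HasCompactSupport φ ∧ tsupport φ ⊆ Ω

/-- `H¹₀(Ω)`, the closure of `C_c^∞(Ω)` in the `H¹(Ω)` norm `(‖u‖² + ‖∇u‖²)^{1/2}`.
An element is stored as the pair `(u, ∇u)`.  For a bounded `C¹` domain these are exactly the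
`H¹` functions with zero trace. -/
def H10Submodule {d : ℕ} (Ω : Set (EPHSpace d)) : Submodule ℝ (EPHPair Ω) :=
  (Submodule.span ℝ {w : EPHPair Ω | ∃ φ : EPHSpace d → ℝ, IsTestFunction Ω φ ∧
    (w.fst : EPHSpace d → ℝ) =ᵐ[volume.restrict Ω] φ ∧
    (w.snd : EPHSpace d → EPHSpace d) =ᵐ[volume.restrict Ω] gradient φ}).topologicalClosure

/-- `H¹₀(Ω)` as a Hilbert space. -/
abbrev H10 {d : ℕ} (Ω : Set (EPHSpace d)) : Type := H10Submodule Ω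

/-- The function underlying an element of `H¹₀(Ω)`. -/
def H10.fn {d : ℕ} {Ω : Set (EPHSpace d)} (w : H10 Ω) : EPHL2 Ω := (w : EPHPair Ω).fst

/-- The weak gradient of an element of `H¹₀(Ω)`. -/
def H10.grad {d : ℕ} {Ω : Set (EPHSpace d)} (w : H10 Ω) : EPHL2Vec Ω := (w : EPHPair Ω).snd

/-- `f ∈ H¹(Ω)`: the function `f ∈ L²(Ω)` has a weak gradient in `L²(Ω; ℝ^d)`. -/
def MemH1 {d : ℕ} (Ω : Set (EPHSpace d)) (f : EPHL2 Ω) : Prop :=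
  ∃ G : EPHL2Vec Ω, ∀ φ : EPHSpace d → ℝ, IsTestFunction Ω φ → ∀ j : Fin d,
    ∫ x in Ω, f x * (gradient φ x) j = -∫ x in Ω, (G x) j * φ x

/-- `H^{-1}(Ω)`, the dual of `H¹₀(Ω)`. -/
abbrev HMinus1 {d : ℕ} (Ω : Set (EPHSpace d)) : Type := StrongDual ℝ (H10 Ω)

/-- Lebesgue measure on the time interval. -/
abbrev timeMeasure (T : ℝ) : Measure ℝ := volume.restrict (Ioc 0 T)

/-- The Bochner space `L²(0,T;X)`. -/
abbrev L2Time (T : ℝ) (X : Type) [NormedAddCommGroup X] : Type := Lp X 2 (timeMeasure T)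

/-- Test functions `C_c^∞(0,T)` in time. -/
def IsTimeTest (T : ℝ) (η : ℝ → ℝ) : Prop :=
  ContDiff ℝ ∞ η ∧ HasCompactSupport η ∧ tsupport η ⊆ Ioo 0 T

/-- `w ∈ L²(0,T;H^{-1}(Ω))` is the weak time derivative of `u ∈ L²(0,T;H¹₀(Ω))`, where
`L²(Ω)` is identified with a subspace of `H^{-1}(Ω)` through the `L²` inner product. -/
def HasTimeDerivHMinus1 {d : ℕ} {Ω : Set (EPHSpace d)} {T : ℝ}
    (u : L2Time T (H10 Ω)) (w : L2Time T (HMinus1 Ω)) : Prop :=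
  ∀ η : ℝ → ℝ, IsTimeTest T η → ∀ φ : H10 Ω,
    ∫ t in Ioc 0 T, deriv η t * inner ℝ (H10.fn (u t)) (H10.fn φ)
      = -∫ t in Ioc 0 T, η t * (w t) φ

/-- The space `𝒲 = {u ∈ L²(0,T;H¹₀(Ω)) : ∂ₜu ∈ L²(0,T;H^{-1}(Ω))}`. -/
def MemW {d : ℕ} {Ω : Set (EPHSpace d)} {T : ℝ} (u : L2Time T (H10 Ω)) : Prop :=
  ∃ w : L2Time T (HMinus1 Ω), HasTimeDerivHMinus1 u w

/-- `w ∈ L²(Q) = L²(0,T;L²(Ω))` is the weak time derivative of `v ∈ L²(0,T;L²(Ω))`. -/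
def HasTimeDerivL2 {d : ℕ} {Ω : Set (EPHSpace d)} {T : ℝ}
    (v w : L2Time T (EPHL2 Ω)) : Prop :=
  ∀ η : ℝ → ℝ, IsTimeTest T η →
    ∫ t in Ioc 0 T, deriv η t • v t = -∫ t in Ioc 0 T, η t • w t

/-- `u(0) = u₀`, read through the representative of `u` in `C([0,T];L²(Ω))`. -/
def HasInitialValue {d : ℕ} {Ω : Set (EPHSpace d)} (T : ℝ) (u : ℝ → EPHL2 Ω)
    (u₀ : EPHL2 Ω) : Prop :=
  ∃ c : ℝ → EPHL2 Ω, ContinuousOn c (Icc 0 T) ∧ (∀ᵐ t ∂timeMeasure T, c t = u t) ∧ c 0 = u₀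

/-! ### Constitutive functions -/

/-- Assumptions on the imbibition and drainage capillary pressure curves on `(0,1]`. -/
structure CapillaryCurves (pcI pcD : ℝ → ℝ) : Prop where
  contDiffI : ContDiffOn ℝ 1 pcI (Ioo 0 1)
  contDiffD : ContDiffOn ℝ 1 pcD (Ioo 0 1)
  contI : ContinuousOn pcI (Ioc 0 1)
  contD : ContinuousOn pcD (Ioc 0 1)
  derivI_neg : ∀ S ∈ Ioo (0 : ℝ) 1, deriv pcI S < 0
  derivD_neg : ∀ S ∈ Ioo (0 : ℝ) 1, deriv pcD S < 0
  lt : ∀ S ∈ Ioo (0 : ℝ) 1, pcI S < pcD S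
  eq_one : pcI 1 = pcD 1
  blowupI : Tendsto pcI (𝓝[>] 0) atTop
  blowupD : Tendsto pcD (𝓝[>] 0) atTop
  steepI : Tendsto (fun S => -deriv pcI S) (𝓝[<] 1) atTop
  steepD : Tendsto (fun S => -deriv pcD S) (𝓝[<] 1) atTop

/-- Assumptions on the relative permeability. -/
structure Permeability (k : ℝ → ℝ) : Prop where
  contDiff : ContDiff ℝ 1 k
  nonneg : 0 ≤ k 0
  left : ∀ S ≤ 0, k S = k 0
  right : ∀ S, 1 ≤ S → k S = k 1
  between : ∀ S ∈ Ioo (0 : ℝ) 1, k 0 < k S ∧ k S < k 1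

/-- Assumptions on the function `b` that determines the scanning curves
`S + b(p) = constant`. -/
structure ScanningFunction (pcI pcD b : ℝ → ℝ) : Prop where
  contDiff : ContDiff ℝ 1 b
  zero : b 0 = 0
  boundI : ∀ S ∈ Ioo (0 : ℝ) 1, 0 < deriv b (pcI S) ∧ deriv b (pcI S) < -1 / deriv pcI S
  boundD : ∀ S ∈ Ioo (0 : ℝ) 1, 0 < deriv b (pcD S) ∧ deriv b (pcD S) < -1 / deriv pcD S
  deriv_nonneg : ∀ p, 0 ≤ deriv b p
  deriv_bdd : ∃ bM : ℝ, ∀ p, deriv b p ≤ bM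

/-- `b(∞)`, the common value of `U_M` and `V_m`. -/
def bInfty (b : ℝ → ℝ) : ℝ := limUnder atTop b

/-- For a capillary curve `pc` (imbibition or drainage), the curve `p = pc(S)` in the variables
`u = b(p)`, `v = S + b(p)`, written as a graph `u = ρ(v)`.  For `V_m < v < V_M`, with
`V_m = b(∞)` and `V_M = 1 + b(pc(1))`, let `S ∈ (0,1)` be the solution of `S + b(pc(S)) = v`;
then `ρ(v) = b(pc(S))`, that is, `ρ` is the inverse of `u ↦ pc⁻¹(b⁻¹(u)) + u`.  It is extended
by `U_M = b(∞)` to `v ≤ V_m` and by `U_m = b(pc(1))` to `v ≥ V_M`. -/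
def rho (b pc : ℝ → ℝ) (v : ℝ) : ℝ :=
  if v ≤ bInfty b then bInfty b
  else if 1 + b (pc 1) ≤ v then b (pc 1)
  else b (pc (Function.invFunOn (fun S => S + b (pc S)) (Ioo 0 1) v))

/-- The regularised hysteresis relation `Φ_τ(u,v)`. -/
def PhiTau (pcI pcD b : ℝ → ℝ) (τ u v : ℝ) : ℝ :=
  (1 / τ) *
    (if rho b pcD v < u then rho b pcD v - u
     else if u < rho b pcI v then rho b pcI v - u
     else 0)

/-- Assumptions on the initial data `S₀ ∈ H¹(Ω)`, `p₀ ∈ H¹₀(Ω)`. -/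
structure InitialData {d : ℕ} {Ω : Set (EPHSpace d)} (pcI pcD : ℝ → ℝ)
    (S₀ : EPHL2 Ω) (p₀ : H10 Ω) : Prop where
  memH1 : MemH1 Ω S₀
  away : ∃ ε > 0, ∀ᵐ x ∂volume.restrict Ω, ε ≤ S₀ x ∧ S₀ x ≤ 1 - ε
  between : ∀ᵐ x ∂volume.restrict Ω, pcI (S₀ x) ≤ H10.fn p₀ x ∧ H10.fn p₀ x ≤ pcD (S₀ x)

/-! ### Weak solutions of the regularised extended play-type hysteresis model -/

/-- `(S, p)` is a weak solution of the model with regularisation parameter `τ`: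
`p ∈ 𝒲`, `S - S₀ ∈ 𝒲` (this difference is `Z`, and `∂ₜS = ∂ₜZ` is `dS`), `S ∈ [0,1]` a.e.,
`p(0) = p₀`, `S(0) = S₀`,
`∫₀ᵀ ⟨∂ₜS, φ⟩ = ∫₀ᵀ (k(S)[∇p - g], ∇φ)` for all `φ ∈ L²(0,T;H¹₀(Ω))`, and
`∫₀ᵀ (∂ₜ(S + b(p)), ξ) = ∫₀ᵀ (Φ_τ(b(p), S + b(p)), ξ)` for all `ξ ∈ L²(Q)`;
the function `S + b(p)` is called `v` and its time derivative `dv`. -/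
def IsEPHWeakSolution {d : ℕ} {Ω : Set (EPHSpace d)} {T : ℝ} (pcI pcD k b : ℝ → ℝ)
    (g : EPHSpace d) (S₀ : EPHL2 Ω) (p₀ : H10 Ω) (τ : ℝ)
    (S : L2Time T (EPHL2 Ω)) (p : L2Time T (H10 Ω)) : Prop :=
  MemW p ∧
  HasInitialValue T (fun t => H10.fn (p t)) (H10.fn p₀) ∧
  HasInitialValue T (fun t => S t) S₀ ∧
  (∀ᵐ t ∂timeMeasure T, ∀ᵐ x ∂volume.restrict Ω, 0 ≤ S t x ∧ S t x ≤ 1) ∧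
  (∃ (Z : L2Time T (H10 Ω)) (dS : L2Time T (HMinus1 Ω)),
    (∀ᵐ t ∂timeMeasure T, S t - S₀ = H10.fn (Z t)) ∧
    HasTimeDerivHMinus1 Z dS ∧
    ∀ φ : L2Time T (H10 Ω),
      ∫ t in Ioc 0 T, (dS t) (φ t)
        = ∫ t in Ioc 0 T, ∫ x in Ω,
            inner ℝ (k (S t x) • (H10.grad (p t) x - g)) (H10.grad (φ t) x)) ∧
  (∃ v dv : L2Time T (EPHL2 Ω),
    (∀ᵐ t ∂timeMeasure T, ∀ᵐ x ∂volume.restrict Ω, v t x = S t x + b (H10.fn (p t) x)) ∧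
    HasTimeDerivL2 v dv ∧
    ∀ ξ : L2Time T (EPHL2 Ω),
      ∫ t in Ioc 0 T, ∫ x in Ω, dv t x * ξ t x
        = ∫ t in Ioc 0 T, ∫ x in Ω,
            PhiTau pcI pcD b τ (b (H10.fn (p t) x)) (v t x) * ξ t x)

/-- The element `u` of `L²(0,T;H¹₀(Ω))` is the function `b(p)`. -/
def IsBOf {d : ℕ} {Ω : Set (EPHSpace d)} {T : ℝ} (b : ℝ → ℝ)
    (p u : L2Time T (H10 Ω)) : Prop :=
  ∀ᵐ t ∂timeMeasure T, ∀ᵐ x ∂volume.restrict Ω, H10.fn (u t) x = b (H10.fn (p t) x)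

end

/-! The estimate is an entropy inequality in which `τ` does not appear. Write u = b(p), v = S + u
and let ρ_d be the drainage curve. For a nondecreasing ψ of class C¹ with ψ(0) = 0 and slope at most
1, put Ψ' = ψ and R' = ψ∘ρ_d. Since ∂ₜu = ∂ₜv - ∂ₜS, formally d/dt ∫Ψ(u) = (∂ₜv, ψ(u)) - ⟨∂ₜS,
ψ(u)⟩. The last pairing is (k(S)[∇p - g], ∇ψ(u)). The regularised relation enters only through a
sign: Φ_τ(u,v)(ψ(u) - ψ(ρ_d(v))) ≤ 0 (`PhiTau_mul_nonpos`), whence (∂ₜv, ψ(u)) ≤ (∂ₜv, ψ(ρ_d(v))) =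
d/dt ∫R(v). Integration in time gives `entropy_inequality`.

With ψ = id the left side contains ½‖u‖² and a dissipation term. As ρ_d is bounded and 0 ≤ S ≤ 1,
∫R(v) grows at most linearly in u and is absorbed by half of ½‖u‖². As |∇u|² = b'(p)²|∇p|² ≤ M
b'(p)|∇p|², the dissipation controls ‖∇u‖², provided that k(S) ≥ κ > 0 with κ independent of `τ`
(`exists_uniform_bound`).

If k(0) > 0 then κ = k(0). If g = 0, the same inequality yields a positive lower bound for S
(`exists_saturation_lower_bound`). Choose s so small that u₀ ≤ K and v₀ ≥ s + K, with K = b(p_d(s)),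
and take ψ positive exactly on (K, ∞). The dissipation is nonnegative, Ψ(u₀) = 0, and R normalised
at s + K satisfies R ≤ 0 and R(v₀) = 0. So Ψ(u) and R(v) vanish at almost every time, which says u ≤
K and v ≥ s + K, that is S = v - u ≥ s.

The formal time derivatives are replaced by one-sided inequalities for convex functionals. If N is a
subgradient of E, then E(c(t)) - E(c(t-h)) ≤ (N(c(t)), c(t) - c(t-h)); averaging in t, dividing by h
and letting h → 0 uses only continuity of translations in L² (`sub_le_integral_pairing`). It is
applied to ∫Ψ(u) and to -∫R(v), both convex because ρ_d is nonincreasing.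

Part (ii) is weak sequential compactness of balls in the Hilbert space L²(0,T;H¹₀); testing on the
set where the bound fails carries the L^∞ bound to the limit. -/

noncomputable section

/-- A function that is nonnegative on the right of a zero has a nonnegative derivative there. -/
lemma HasDerivAt.nonneg_of_nonneg_right {P : ℝ → ℝ} {P' δ : ℝ} (hP : HasDerivAt P P' 0)
    (h0 : P 0 = 0) (hδ : 0 < δ) (hpos : ∀ h ∈ Ioo 0 δ, 0 ≤ P h) : 0 ≤ P' := by
  have h1 := (hasDerivAt_iff_tendsto_slope.1 hP).mono_left
    (nhdsWithin_mono (0 : ℝ) (fun x (hx : x ∈ Ioi (0 : ℝ)) => (ne_of_gt hx : x ≠ 0)))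
  refine ge_of_tendsto h1 ?_
  filter_upwards [Ioo_mem_nhdsGT hδ] with h hh
  rw [slope_def_field, h0]
  have := hpos h hh
  have := hh.1
  simp only [sub_zero]
  positivity

/-! ### One-sided chain rule through backward difference quotients. -/

section Energy

variable {V : Type*} [NormedAddCommGroup V] [NormedSpace ℝ V]

/-- Translations act continuously on the pairing of square integrable functions. -/
lemma continuous_integral_translate_pairing {D : ℝ → StrongDual ℝ V} {w : ℝ → V}
    (hD : MemLp D 2 volume) (hw : MemLp w 2 volume) :
    Continuous fun r => ∫ t, D (t - r) (w t) := by
  have hmp : ∀ r : ℝ, MeasurePreserving (fun t => t - r) (volume : Measure ℝ) volume :=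
    fun r => measurePreserving_sub_right volume r
  let tr : C(ℝ, C(ℝ, ℝ)) := ContinuousMap.curry ⟨fun q : ℝ × ℝ => q.2 - q.1, by fun_prop⟩
  have hc : Continuous fun r : ℝ =>
      (Lp.compMeasurePreserving (E := StrongDual ℝ V) (p := 2) (tr r) (hmp r)) (hD.toLp D) :=
    Continuous.compMeasurePreservingLp (Z := ℝ) continuous_const tr.continuous hmp (by simp)
  let B : Lp (StrongDual ℝ V) 2 (volume : Measure ℝ) →L[ℝ] Lp V 2 (volume : Measure ℝ) →L[ℝ] ℝ :=
    ContinuousLinearMap.lpPairing volume 2 2 (ContinuousLinearMap.id ℝ (StrongDual ℝ V))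
  have hq : ∀ r, B ((Lp.compMeasurePreserving (E := StrongDual ℝ V) (p := 2) (tr r) (hmp r))
      (hD.toLp D)) (hw.toLp w) = ∫ t, D (t - r) (w t) := by
    intro r
    rw [ContinuousLinearMap.lpPairing_eq_integral]
    refine integral_congr_ae ?_
    have h1 := Lp.coeFn_compMeasurePreserving (hD.toLp D) (hmp r)
    have h2 := (hmp r).quasiMeasurePreserving.ae_eq_comp hD.coeFn_toLp
    filter_upwards [h1, h2, hw.coeFn_toLp] with t h1 h2 h3
    simp only [Function.comp] at h1 h2
    have h4 : (Lp.compMeasurePreserving (E := StrongDual ℝ V) (p := 2) (tr r) (hmp r)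
      (hD.toLp D)) t = D (t - r) := h1.trans h2
    rw [h4, h3]
    rfl
  simp_rw [← hq]
  exact (B.continuous.comp hc).clm_apply continuous_const

/-- If the increments of a continuous function `E` over `(t - h, t)` are bounded by the increments
of a primitive of `D`, paired with `w t`, then `E s - E 0` is at most the integral of the
pairing of `D` and `w`. -/
theorem sub_le_integral_pairing {E : ℝ → ℝ} (hE : Continuous E) {D : ℝ → StrongDual ℝ V}
    {w : ℝ → V} (hD : MemLp D 2 volume) (hD1 : Integrable D volume) {s : ℝ} (hs : 0 < s)
    (hw : MemLp w 2 (volume.restrict (Ioc 0 s)))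
    (hinc : ∀ᵐ t ∂volume.restrict (Ioc 0 s), ∀ h, 0 < h → h < 1 →
      E t - E (t - h) ≤ (∫ r in (t - h)..t, D r) (w t)) :
    E s - E 0 ≤ ∫ t in Ioc 0 s, D t (w t) := by
  set W := indicator (Ioc 0 s) w with hW
  have hWm : MemLp W 2 volume := (memLp_indicator_iff_restrict measurableSet_Ioc).2 hw
  have hW1 : Integrable W volume :=
    (integrable_indicator_iff measurableSet_Ioc).2 (hw.integrable (by norm_num))
  -- q(r) pairs w with D delayed by r. The increments averaged over t become ∫₀ʰ q by Fubini, and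
  -- continuity of q at 0 replaces any regularity of D in time.
  set q : ℝ → ℝ := fun r => ∫ t, D (t - r) (W t) with hq
  have hqc : Continuous q := continuous_integral_translate_pairing hD hWm
  have hint : Integrable (fun z : ℝ × ℝ => D (z.2 - z.1) (W z.2)) (volume.prod volume) := by
    -- This is the integrand of the convolution of W with the reflection t ↦ D(-t).
    have := hW1.convolution_integrand (ContinuousLinearMap.id ℝ (StrongDual ℝ V)).flip
      (hD1.comp_neg)
    refine this.congr (Eventually.of_forall fun z => ?_)
    simp
  have hqi : ∀ h, 0 < h → h < 1 → ∫ t in (0 : ℝ)..s, (E t - E (t - h)) ≤ ∫ r in (0 : ℝ)..h, q r := by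
    intro h h0 h1
    have hint' : Integrable (Function.uncurry fun r t => D (t - r) (W t))
        ((volume.restrict (Ioc 0 h)).prod (volume.restrict (Ioc 0 s))) := by
      refine hint.mono_measure ?_
      rw [Measure.prod_restrict]
      exact Measure.restrict_le_self
    have e1 : ∀ r, q r = ∫ t in Ioc 0 s, D (t - r) (W t) := by
      intro r
      refine (setIntegral_eq_integral_of_forall_compl_eq_zero fun t ht => ?_).symm
      simp [hW, ht]
    rw [intervalIntegral.integral_of_le hs.le, intervalIntegral.integral_of_le h0.le]
    simp_rw [e1]
    rw [integral_integral_swap hint']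
    refine integral_mono_ae ?_ hint'.integral_prod_right ?_
    · exact (by fun_prop : Continuous fun t => E t - E (t - h)).integrableOn_Ioc
    · filter_upwards [hinc, ae_restrict_mem measurableSet_Ioc] with t ht hts
      refine (ht h h0 h1).trans_eq ?_
      rw [← intervalIntegral.integral_of_le h0.le]
      have hcl : ∫ r in (0 : ℝ)..h, D (t - r) (W t) = (∫ r in (0 : ℝ)..h, D (t - r)) (W t) := by
        rw [ContinuousLinearMap.intervalIntegral_apply]
        exact (hD1.comp_sub_left t).intervalIntegrable
      rw [hcl, intervalIntegral.integral_comp_sub_left (fun r => D r), sub_zero]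
      simp [hW, hts]
  -- P is nonnegative on (0,1) and vanishes at 0; its derivative there is q(0) - (E s - E 0), whose
  -- sign is the claim.
  set P : ℝ → ℝ := fun h => (∫ r in (0 : ℝ)..h, q r) -
    ((∫ t in (0 : ℝ)..s, E t) - ∫ t in (0 - h)..(s - h), E t) with hP
  have hII : ∀ a b : ℝ, IntervalIntegrable E volume a b := fun a b => hE.intervalIntegrable a b
  have hPd : HasDerivAt P (q 0 - (0 - ((-1) * E s - (-1) * E 0))) 0 := by
    have d1 : HasDerivAt (fun h => ∫ r in (0 : ℝ)..h, q r) (q 0) 0 :=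
      (hqc.integral_hasStrictDerivAt 0 0).hasDerivAt
    have d2 : ∀ a : ℝ, HasDerivAt (fun h : ℝ => ∫ r in (0 : ℝ)..(a - h), E r) ((-1) * E a) 0 := by
      intro a
      have := (hE.integral_hasStrictDerivAt 0 (a - 0)).hasDerivAt.comp (0 : ℝ)
        ((hasDerivAt_id (0 : ℝ)).const_sub a)
      refine this.congr_deriv ?_
      simp [mul_comm]
    have e : P = fun h => (∫ r in (0 : ℝ)..h, q r) - ((∫ t in (0 : ℝ)..s, E t) -
        ((∫ t in (0 : ℝ)..(s - h), E t) - ∫ t in (0 : ℝ)..(0 - h), E t)) := by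
      funext h
      rw [hP, intervalIntegral.integral_interval_sub_left (hII _ _) (hII _ _)]
    rw [e]
    exact d1.sub ((hasDerivAt_const _ _).sub ((d2 s).sub (d2 0)))
  have hP0 : P 0 = 0 := by simp [hP]
  have hPn : ∀ h ∈ Ioo (0 : ℝ) 1, 0 ≤ P h := by
    intro h hh
    have := hqi h hh.1 hh.2
    rw [intervalIntegral.integral_sub (hII _ _) ((by fun_prop : Continuous fun t => E (t - h)).intervalIntegrable _ _),
      intervalIntegral.integral_comp_sub_right (fun t => E t)] at this
    simp only [hP]
    linarith
  have h3 := hPd.nonneg_of_nonneg_right hP0 one_pos hPn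
  have e0 : q 0 = ∫ t in Ioc 0 s, D t (w t) := by
    rw [hq, ← integral_indicator measurableSet_Ioc]
    refine integral_congr_ae (Eventually.of_forall fun t => ?_)
    by_cases ht : t ∈ Ioc 0 s <;> simp [hW, ht]
  rw [← e0]
  linarith

end Energy

/-! ### Distributional derivatives of scalar functions on (0, T). -/

section WeakDerivative

lemma ContDiff.integral_right {f : ℝ → ℝ} (hf : ContDiff ℝ ∞ f) (a : ℝ) :
    ContDiff ℝ ∞ fun t => ∫ x in a..t, f x := by
  have hd : ∀ t, HasDerivAt (fun t => ∫ x in a..t, f x) (f t) t :=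
    fun t => (hf.continuous.integral_hasStrictDerivAt a t).hasDerivAt
  rw [contDiff_infty_iff_deriv]
  refine ⟨fun t => (hd t).differentiableAt, ?_⟩
  rwa [show deriv (fun t => ∫ x in a..t, f x) = f from funext fun t => (hd t).deriv]

/-- A test function on `(0,T)` of zero integral is the derivative of a test function. -/
lemma IsTimeTest.exists_primitive {T : ℝ} (hT : 0 < T) {z : ℝ → ℝ} (hz : IsTimeTest T z)
    (h0 : ∫ t in (0 : ℝ)..T, z t = 0) : ∃ η, IsTimeTest T η ∧ deriv η = z := by
  obtain ⟨hz1, hz2, hz3⟩ := hz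
  have hd : ∀ t, HasDerivAt (fun t => ∫ x in (0 : ℝ)..t, z x) (z t) t :=
    fun t => (hz1.continuous.integral_hasStrictDerivAt 0 t).hasDerivAt
  obtain ⟨a, b, ha, hb, hab⟩ : ∃ a b, 0 < a ∧ b < T ∧ tsupport z ⊆ Icc a b := by
    rcases (tsupport z).eq_empty_or_nonempty with he | hne
    -- For z = 0 the interval [T, 0] is empty, which is all that is needed.
    · exact ⟨T, 0, hT, hT, by simp [he]⟩
    · obtain ⟨a, ha⟩ := hz2.isCompact.exists_isLeast hne
      obtain ⟨b, hb⟩ := hz2.isCompact.exists_isGreatest hne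
      exact ⟨a, b, (hz3 ha.1).1, (hz3 hb.1).2, fun x hx => ⟨ha.2 hx, hb.2 hx⟩⟩
  have hz0 : ∀ x, x ∉ Icc a b → z x = 0 := fun x hx => image_eq_zero_of_notMem_tsupport
    fun h => hx (hab h)
  have hsub : tsupport (fun t => ∫ x in (0 : ℝ)..t, z x) ⊆ Icc a b := by
    refine closure_minimal (fun t ht => ?_) isClosed_Icc
    by_contra hcon
    apply ht
    simp only
    rw [mem_Icc, not_and_or, not_le, not_le] at hcon
    rcases hcon with h | h
    · refine intervalIntegral.integral_zero_ae (Eventually.of_forall fun x hx => hz0 x fun hx2 => ?_)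
      rcases mem_uIoc.1 hx with h3 | h3 <;> [linarith [hx2.1, h3.2]; linarith [hx2.1, h3.2]]
    · rw [← intervalIntegral.integral_add_adjacent_intervals
        (hz1.continuous.intervalIntegrable 0 T) (hz1.continuous.intervalIntegrable T t), h0, zero_add]
      refine intervalIntegral.integral_zero_ae (Eventually.of_forall fun x hx => hz0 x fun hx2 => ?_)
      rcases mem_uIoc.1 hx with h3 | h3 <;> linarith [hx2.2, h3.1]
  refine ⟨fun t => ∫ x in (0 : ℝ)..t, z x, ⟨hz1.integral_right 0, ?_, ?_⟩, funext fun t => (hd t).deriv⟩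
  · exact HasCompactSupport.of_support_subset_isCompact isCompact_Icc
      ((subset_tsupport _).trans hsub)
  · exact hsub.trans fun x hx => ⟨ha.trans_le hx.1, hx.2.trans_lt hb⟩

/-- A continuous function whose distributional derivative vanishes is constant. -/
lemma eq_of_forall_integral_deriv_mul_eq_zero {T : ℝ} (hT : 0 < T) {f : ℝ → ℝ}
    (hf : ContinuousOn f (Icc 0 T))
    (hz : ∀ η, IsTimeTest T η → ∫ t in Ioc 0 T, deriv η t * f t = 0) :
    ∀ t ∈ Icc 0 T, f t = f 0 := by
  -- A bump ω of unit mass supported in (0,T). For a test function z, z - (∫z)ω has zero integral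
  -- and is thus η' for a test function η; the hypothesis then identifies f with its ω-mean.
  let B : ContDiffBump (T / 2) := ⟨T / 8, T / 4, by linarith, by linarith⟩
  have hω : IsTimeTest T (B.normed volume) := by
    refine ⟨B.contDiff_normed, B.hasCompactSupport_normed, ?_⟩
    rw [B.tsupport_normed_eq, Real.closedBall_eq_Icc]
    intro x hx
    simp only [mem_Icc, mem_Ioo, B] at hx ⊢
    constructor <;> linarith [hx.1, hx.2]
  have hωi : ∫ t in Ioc 0 T, B.normed volume t = 1 := by
    rw [setIntegral_eq_integral_of_forall_compl_eq_zero, B.integral_normed]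
    intro x hx
    exact image_eq_zero_of_notMem_tsupport fun h => hx (Ioo_subset_Ioc_self (hω.2.2 h))
  have hfi : IntegrableOn f (Ioc 0 T) := (hf.integrableOn_Icc).mono_set Ioc_subset_Icc_self
  have hmul : ∀ z : ℝ → ℝ, Continuous z → IntegrableOn (fun t => z t * f t) (Ioc 0 T) := fun z hz =>
    ((hz.continuousOn.mul hf).integrableOn_Icc).mono_set Ioc_subset_Icc_self
  set c := ∫ t in Ioc 0 T, B.normed volume t * f t
  have hae : ∀ᵐ t ∂volume, t ∈ Ioo 0 T → f t - c = 0 := by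
    refine isOpen_Ioo.ae_eq_zero_of_integral_contDiff_smul_eq_zero ?_ ?_
    · exact ((hfi.mono_set Ioo_subset_Ioc_self).sub (integrableOn_const (by simp))).locallyIntegrableOn
    · intro z hz1 hz2 hz3
      have hzi : ∀ F : ℝ → ℝ, ∫ t, z t * F t = ∫ t in Ioc 0 T, z t * F t := fun F =>
        (setIntegral_eq_integral_of_forall_compl_eq_zero fun x hx => by
          rw [image_eq_zero_of_notMem_tsupport fun h => hx (Ioo_subset_Ioc_self (hz3 h)),
            zero_mul]).symm
      simp only [smul_eq_mul]
      rw [hzi]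
      set I := ∫ t in Ioc 0 T, z t
      have hzt : IsTimeTest T (fun t => z t - I * B.normed volume t) := by
        refine ⟨hz1.sub (contDiff_const.mul hω.1), hz2.sub (hω.2.1.mul_left), ?_⟩
        refine (tsupport_sub _ _).trans (union_subset hz3 ?_)
        exact (tsupport_mul_subset_right).trans hω.2.2
      obtain ⟨η, hη, hη'⟩ := hzt.exists_primitive hT (by
        rw [intervalIntegral.integral_of_le hT.le, integral_sub, integral_const_mul, hωi, mul_one,
          sub_self]
        · exact hz1.continuous.integrableOn_Ioc
        · exact (continuous_const.mul hω.1.continuous).integrableOn_Ioc)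
      have h1 := hz η hη
      rw [hη'] at h1
      have e1 : ∫ t in Ioc 0 T, (z t - I * B.normed volume t) * f t
          = (∫ t in Ioc 0 T, z t * f t) - I * c := by
        rw [← integral_const_mul, ← integral_sub (hmul z hz1.continuous)
          ((hmul _ hω.1.continuous).const_mul I)]
        exact integral_congr_ae (Eventually.of_forall fun t => by ring)
      have e2 : ∫ t in Ioc 0 T, z t * (f t - c) = (∫ t in Ioc 0 T, z t * f t) - I * c := by
        rw [← integral_mul_const, ← integral_sub (hmul z hz1.continuous)]
        · exact integral_congr_ae (Eventually.of_forall fun t => by ring)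
        · exact hz1.continuous.integrableOn_Ioc.mul_const c
      rw [e2, ← e1, h1]
  have hEq : EqOn f (fun _ => c) (Icc 0 T) := by
    refine Measure.eqOn_Icc_of_ae_eq volume hT.ne ?_ hf continuousOn_const
    rw [← restrict_Ioo_eq_restrict_Icc, Filter.EventuallyEq, ae_restrict_iff' measurableSet_Ioo]
    filter_upwards [hae] with t ht hm
    linarith [ht hm]
  intro t ht
  rw [hEq ht, hEq (left_mem_Icc.2 hT.le)]

/-- A continuous function with integrable distributional derivative is a primitive of it. -/
theorem eq_add_integral_of_weak_deriv {T : ℝ} (hT : 0 < T) {f g : ℝ → ℝ}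
    (hf : ContinuousOn f (Icc 0 T)) (hg : IntegrableOn g (Ioc 0 T))
    (hz : ∀ η, IsTimeTest T η →
      ∫ t in Ioc 0 T, deriv η t * f t = -∫ t in Ioc 0 T, η t * g t) :
    ∀ t ∈ Icc 0 T, f t = f 0 + ∫ x in (0 : ℝ)..t, g x := by
  have hgi : IntervalIntegrable g volume 0 T := (intervalIntegrable_iff_integrableOn_Ioc_of_le hT.le).2 hg
  set G : ℝ → ℝ := fun t => ∫ x in (0 : ℝ)..t, g x with hGd
  have hG : AbsolutelyContinuousOnInterval G 0 T :=
    hgi.absolutelyContinuousOnInterval_intervalIntegral left_mem_uIcc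
  have hGc : ContinuousOn G (Icc 0 T) := by simpa [uIcc_of_le hT.le] using hG.continuousOn
  -- The primitive G of g is absolutely continuous, so integration by parts shows that f - G has
  -- zero distributional derivative.
  have key := eq_of_forall_integral_deriv_mul_eq_zero hT (hf.sub hGc) (fun η hη => by
    have hηd : Continuous (deriv η) := hη.1.continuous_deriv (by simp)
    have hηac : AbsolutelyContinuousOnInterval η 0 T :=
      ContDiffOn.absolutelyContinuousOnInterval (hη.1.of_le (by simp)).contDiffOn
    have hη0 : ∀ x, x ∉ Ioo 0 T → η x = 0 := fun x hx =>
      image_eq_zero_of_notMem_tsupport fun h => hx (hη.2.2 h)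
    have ibp := hG.integral_mul_deriv_eq_deriv_mul hηac
    rw [hη0 T (by simp), hη0 0 (by simp), intervalIntegral.integral_of_le hT.le,
      intervalIntegral.integral_of_le hT.le] at ibp
    have hdG : ∀ᵐ x ∂volume.restrict (Ioc 0 T), deriv G x * η x = η x * g x := by
      rw [ae_restrict_iff' measurableSet_Ioc]
      filter_upwards [hgi.ae_hasDerivAt_integral] with x hx hxT
      rw [(hx (by rw [uIcc_of_le hT.le]; exact Ioc_subset_Icc_self hxT) 0 left_mem_uIcc).deriv]; ring
    rw [integral_congr_ae hdG] at ibp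
    have h2 : ∀ F : ℝ → ℝ, ContinuousOn F (Icc 0 T) → IntegrableOn (fun t => deriv η t * F t) (Ioc 0 T) :=
      fun F hF => ((hηd.continuousOn.mul hF).integrableOn_Icc).mono_set Ioc_subset_Icc_self
    have e : ∫ t in Ioc 0 T, deriv η t * (f t - G t) =
        (∫ t in Ioc 0 T, deriv η t * f t) - ∫ t in Ioc 0 T, G t * deriv η t := by
      rw [← integral_sub (h2 f hf) ((h2 G hGc).congr (Eventually.of_forall fun t => by ring_nf))]
      exact integral_congr_ae (Eventually.of_forall fun t => by ring)
    show ∫ t in Ioc 0 T, deriv η t * (f t - G t) = 0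
    rw [e, hz η hη, ibp]; ring)
  intro t ht
  have := key t ht
  simp only [Pi.sub_apply, hGd, intervalIntegral.integral_same, sub_zero] at this ⊢
  linarith

end WeakDerivative

/-! ### Superposition operators on L². -/

section Nemytskii

variable {α : Type*} {m : MeasurableSpace α} {μ : Measure α}
  {E : Type*} [NormedAddCommGroup E] [InnerProductSpace ℝ E]

lemma MeasureTheory.L2.norm_sq_eq_integral (f : Lp E 2 μ) : ‖f‖ ^ 2 = ∫ x, ‖f x‖ ^ 2 ∂μ := by
  rw [← real_inner_self_eq_norm_sq, L2.inner_def]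
  exact integral_congr_ae (Eventually.of_forall fun x => real_inner_self_eq_norm_sq _)

lemma MeasureTheory.L2.integrable_norm_sq {F : Type*} [NormedAddCommGroup F] (f : Lp F 2 μ) : Integrable (fun x => ‖f x‖ ^ 2) μ :=
  (Lp.memLp f).integrable_norm_pow (by norm_num)

/-- Dominated convergence in `L²`. -/
lemma MeasureTheory.L2.tendsto_of_dominated {F : ℕ → Lp E 2 μ} {f G : Lp E 2 μ} {C : ℝ}
    (hb : ∀ n, ∀ᵐ x ∂μ, ‖F n x - f x‖ ≤ C * ‖G x‖)
    (hl : ∀ᵐ x ∂μ, Tendsto (fun n => F n x) atTop (𝓝 (f x))) :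
    Tendsto F atTop (𝓝 f) := by
  rw [tendsto_iff_norm_sub_tendsto_zero]
  have h1 : Tendsto (fun n => ‖F n - f‖ ^ 2) atTop (𝓝 0) := by
    have h2 : Tendsto (fun n => ∫ x, ‖F n x - f x‖ ^ 2 ∂μ) atTop (𝓝 (∫ _, (0 : ℝ) ∂μ)) := by
      refine tendsto_integral_of_dominated_convergence (fun x => C ^ 2 * ‖G x‖ ^ 2)
        (fun n => ?_) ((L2.integrable_norm_sq G).const_mul _) (fun n => ?_) ?_
      · exact (((Lp.aestronglyMeasurable (F n)).sub (Lp.aestronglyMeasurable f)).norm.pow 2)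
      · filter_upwards [hb n] with x hx
        rw [Real.norm_eq_abs, abs_of_nonneg (by positivity), ← mul_pow]
        exact pow_le_pow_left₀ (norm_nonneg _) hx 2
      · filter_upwards [hl] with x hx
        have := ((hx.sub_const (f x)).norm).pow 2
        simpa using this
    rw [integral_zero] at h2
    refine h2.congr fun n => ?_
    rw [L2.norm_sq_eq_integral]
    refine integral_congr_ae ?_
    filter_upwards [Lp.coeFn_sub (F n) f] with x hx
    rw [hx]; rfl
  have := h1.sqrt
  simpa using this

variable {θ : ℝ → ℝ} {C : ℝ}

lemma memLp_bdd_comp_smul (hθ : Continuous θ) (hC : ∀ x, |θ x| ≤ C) (f : Lp ℝ 2 μ)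
    (G : Lp E 2 μ) : MemLp (fun x => θ (f x) • G x) 2 μ := by
  refine (Lp.memLp G).of_le_mul (c := C)
    ((hθ.comp_aestronglyMeasurable (Lp.aestronglyMeasurable f)).smul (Lp.aestronglyMeasurable G)) ?_
  refine Eventually.of_forall fun x => ?_
  rw [norm_smul]
  exact mul_le_mul_of_nonneg_right (hC _) (norm_nonneg _)

/-- The map `(f, G) ↦ θ(f) G` on `L²`, for a bounded continuous function `θ`. -/
def bddCompSmul (hθ : Continuous θ) (hC : ∀ x, |θ x| ≤ C) (f : Lp ℝ 2 μ) (G : Lp E 2 μ) :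
    Lp E 2 μ := (memLp_bdd_comp_smul hθ hC f G).toLp _

lemma coeFn_bddCompSmul (hθ : Continuous θ) (hC : ∀ x, |θ x| ≤ C) (f : Lp ℝ 2 μ) (G : Lp E 2 μ) :
    bddCompSmul hθ hC f G =ᵐ[μ] fun x => θ (f x) • G x := MemLp.coeFn_toLp _

lemma norm_bddCompSmul_le (hθ : Continuous θ) (hC : ∀ x, |θ x| ≤ C) (f : Lp ℝ 2 μ)
    (G : Lp E 2 μ) : ‖bddCompSmul hθ hC f G‖ ≤ C * ‖G‖ := by
  refine Lp.norm_le_mul_norm_of_ae_le_mul ?_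
  filter_upwards [coeFn_bddCompSmul hθ hC f G] with x hx
  rw [hx, norm_smul]
  exact mul_le_mul_of_nonneg_right (hC _) (norm_nonneg _)

/-- An L²-convergent sequence has an a.e. convergent subsequence, along which 2C|G| dominates;
boundedness of θ is what permits an arbitrary G in L². -/
lemma continuous_bddCompSmul_left (hθ : Continuous θ) (hC : ∀ x, |θ x| ≤ C) (G : Lp E 2 μ) :
    Continuous fun f : Lp ℝ 2 μ => bddCompSmul hθ hC f G := by
  rw [continuous_iff_seqContinuous]
  intro F f hF
  refine tendsto_of_subseq_tendsto fun ns hns => ?_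
  obtain ⟨ms, -, hms⟩ := (tendstoInMeasure_of_tendsto_Lp (hF.comp hns)).exists_seq_tendsto_ae
  refine ⟨ms, L2.tendsto_of_dominated (G := G) (C := C + C) (fun n => ?_) ?_⟩
  · filter_upwards [coeFn_bddCompSmul hθ hC (F (ns (ms n))) G, coeFn_bddCompSmul hθ hC f G]
      with x h1 h2
    simp only [Function.comp]
    rw [h1, h2, ← sub_smul, norm_smul]
    refine mul_le_mul_of_nonneg_right ?_ (norm_nonneg _)
    exact (norm_sub_le _ _).trans (add_le_add (hC _) (hC _))
  · have h1 : ∀ᵐ x ∂μ, ∀ n, bddCompSmul hθ hC (F (ns (ms n))) G x = θ (F (ns (ms n)) x) • G x :=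
      ae_all_iff.2 fun n => coeFn_bddCompSmul hθ hC (F (ns (ms n))) G
    filter_upwards [h1, coeFn_bddCompSmul hθ hC f G, hms] with x h1 h2 h3
    simp only [Function.comp, h1]
    rw [h2]
    exact ((hθ.tendsto _).comp h3).smul_const _

/-- The operator is linear in G with norm at most C uniformly in f, so joint continuity reduces to
continuity in f at a fixed G. -/
lemma continuous_bddCompSmul (hθ : Continuous θ) (hC : ∀ x, |θ x| ≤ C) :
    Continuous fun z : Lp ℝ 2 μ × Lp E 2 μ => bddCompSmul hθ hC z.1 z.2 := by
  rw [continuous_iff_continuousAt]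
  rintro ⟨f, G⟩
  rw [ContinuousAt, tendsto_iff_norm_sub_tendsto_zero]
  have hb : ∀ z : Lp ℝ 2 μ × Lp E 2 μ, ‖bddCompSmul hθ hC z.1 z.2 - bddCompSmul hθ hC f G‖ ≤
      C * ‖z.2 - G‖ + ‖bddCompSmul hθ hC z.1 G - bddCompSmul hθ hC f G‖ := by
    intro z
    have e : bddCompSmul hθ hC z.1 z.2 - bddCompSmul hθ hC z.1 G
        = bddCompSmul hθ hC z.1 (z.2 - G) := by
      apply Lp.ext
      filter_upwards [coeFn_bddCompSmul hθ hC z.1 z.2, coeFn_bddCompSmul hθ hC z.1 G,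
        coeFn_bddCompSmul hθ hC z.1 (z.2 - G), Lp.coeFn_sub z.2 G,
        Lp.coeFn_sub (bddCompSmul hθ hC z.1 z.2) (bddCompSmul hθ hC z.1 G)] with x h1 h2 h3 h4 h5
      rw [h5, h3, Pi.sub_apply, h1, h2, h4, Pi.sub_apply, smul_sub]
    calc _ ≤ ‖bddCompSmul hθ hC z.1 z.2 - bddCompSmul hθ hC z.1 G‖ +
          ‖bddCompSmul hθ hC z.1 G - bddCompSmul hθ hC f G‖ := norm_sub_le_norm_sub_add_norm_sub _ _ _
      _ ≤ _ := by
        rw [e]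
        exact add_le_add_left (norm_bddCompSmul_le hθ hC _ _) _
  have hcont : Continuous fun z : Lp ℝ 2 μ × Lp E 2 μ =>
      C * ‖z.2 - G‖ + ‖bddCompSmul hθ hC z.1 G - bddCompSmul hθ hC f G‖ := by
    have := (continuous_bddCompSmul_left hθ hC G).comp (continuous_fst (X := Lp ℝ 2 μ) (Y := Lp E 2 μ))
    have h2 : Continuous fun z : Lp ℝ 2 μ × Lp E 2 μ => bddCompSmul hθ hC z.1 G := this
    fun_prop
  refine squeeze_zero (fun _ => norm_nonneg _) hb ?_
  have := hcont.tendsto (f, G)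
  simpa using this

variable [IsFiniteMeasure μ]

/-- The map `f ↦ θ(f)` on `L²` of a finite measure, for a bounded continuous function `θ`. -/
def bddComp (hθ : Continuous θ) (hC : ∀ x, |θ x| ≤ C) (f : Lp ℝ 2 μ) : Lp ℝ 2 μ :=
  bddCompSmul hθ hC f (Lp.const 2 μ (1 : ℝ))

lemma coeFn_bddComp (hθ : Continuous θ) (hC : ∀ x, |θ x| ≤ C) (f : Lp ℝ 2 μ) :
    bddComp hθ hC f =ᵐ[μ] fun x => θ (f x) := by
  filter_upwards [coeFn_bddCompSmul hθ hC f (Lp.const 2 μ (1 : ℝ)), Lp.coeFn_const (μ := μ) 2 (1 : ℝ)]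
    with x h1 h2
  rw [bddComp, h1, h2]
  simp

lemma continuous_bddComp (hθ : Continuous θ) (hC : ∀ x, |θ x| ≤ C) :
    Continuous fun f : Lp ℝ 2 μ => bddComp hθ hC f := continuous_bddCompSmul_left hθ hC _

end Nemytskii

/-! ### Test functions and density in H¹₀. -/

section Sobolev

variable {d : ℕ} {Ω : Set (EPHSpace d)}

lemma continuous_gradient {φ : EPHSpace d → ℝ} (h : ContDiff ℝ ∞ φ) :
    Continuous (gradient φ) :=
  (InnerProductSpace.toDual ℝ (EPHSpace d)).symm.continuous.comp (h.continuous_fderiv (by simp))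

lemma HasCompactSupport.gradient {φ : EPHSpace d → ℝ} (h : HasCompactSupport φ) :
    HasCompactSupport (gradient φ) :=
  (h.fderiv (𝕜 := ℝ)).comp_left (g := (InnerProductSpace.toDual ℝ (EPHSpace d)).symm) (by simp)

/-- The embedding of test functions into pairs (function, gradient). -/
def testPair (Ω : Set (EPHSpace d)) {φ : EPHSpace d → ℝ} (h : IsTestFunction Ω φ) : EPHPair Ω :=
  WithLp.toLp 2
    ((h.1.continuous.memLp_of_hasCompactSupport h.2.1).restrict Ω |>.toLp φ,
      ((continuous_gradient h.1).memLp_of_hasCompactSupport h.2.1.gradient).restrict Ω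
        |>.toLp (gradient φ))

lemma coeFn_testPair_fst {φ : EPHSpace d → ℝ} (h : IsTestFunction Ω φ) :
    ((testPair Ω h).fst : EPHSpace d → ℝ) =ᵐ[volume.restrict Ω] φ :=
  MemLp.coeFn_toLp ((h.1.continuous.memLp_of_hasCompactSupport h.2.1).restrict Ω)

lemma coeFn_testPair_snd {φ : EPHSpace d → ℝ} (h : IsTestFunction Ω φ) :
    ((testPair Ω h).snd : EPHSpace d → EPHSpace d) =ᵐ[volume.restrict Ω] gradient φ :=
  MemLp.coeFn_toLp
    (((continuous_gradient h.1).memLp_of_hasCompactSupport h.2.1.gradient).restrict Ω)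

lemma testPair_mem {φ : EPHSpace d → ℝ} (h : IsTestFunction Ω φ) :
    testPair Ω h ∈ H10Submodule Ω :=
  Submodule.le_topologicalClosure _ (Submodule.subset_span
    ⟨φ, h, coeFn_testPair_fst h, coeFn_testPair_snd h⟩)

lemma eq_testPair {φ : EPHSpace d → ℝ} (h : IsTestFunction Ω φ) {w : EPHPair Ω}
    (h1 : (w.fst : EPHSpace d → ℝ) =ᵐ[volume.restrict Ω] φ)
    (h2 : (w.snd : EPHSpace d → EPHSpace d) =ᵐ[volume.restrict Ω] gradient φ) :
    w = testPair Ω h := by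
  have e1 : w.fst = (testPair Ω h).fst := Lp.ext (h1.trans (coeFn_testPair_fst h).symm)
  have e2 : w.snd = (testPair Ω h).snd := Lp.ext (h2.trans (coeFn_testPair_snd h).symm)
  apply WithLp.ofLp_injective
  exact Prod.ext e1 e2

lemma IsTestFunction.zero : IsTestFunction Ω (fun _ => (0 : ℝ)) :=
  ⟨contDiff_const, HasCompactSupport.zero, by simp [tsupport]⟩

lemma IsTestFunction.add {φ ψ : EPHSpace d → ℝ} (h : IsTestFunction Ω φ) (h' : IsTestFunction Ω ψ) :
    IsTestFunction Ω (fun x => φ x + ψ x) :=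
  ⟨h.1.add h'.1, h.2.1.add h'.2.1, (tsupport_add φ ψ).trans (union_subset h.2.2 h'.2.2)⟩

lemma IsTestFunction.smul {φ : EPHSpace d → ℝ} (h : IsTestFunction Ω φ) (a : ℝ) :
    IsTestFunction Ω (fun x => a * φ x) :=
  ⟨contDiff_const.mul h.1, h.2.1.mul_left, (tsupport_mul_subset_right).trans h.2.2⟩

lemma IsTestFunction.hasGradientAt {φ : EPHSpace d → ℝ} (h : IsTestFunction Ω φ) (x : EPHSpace d) :
    HasGradientAt φ (gradient φ x) x :=
  (h.1.differentiable (by simp) x).hasGradientAt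

lemma IsTestFunction.hasGradientAt_add {φ ψ : EPHSpace d → ℝ} (h : IsTestFunction Ω φ)
    (h' : IsTestFunction Ω ψ) (x : EPHSpace d) :
    HasGradientAt (fun x => φ x + ψ x) (gradient φ x + gradient ψ x) x := by
  rw [hasGradientAt_iff_hasFDerivAt, map_add]
  exact (h.hasGradientAt x).hasFDerivAt.add (h'.hasGradientAt x).hasFDerivAt

lemma IsTestFunction.hasGradientAt_smul {φ : EPHSpace d → ℝ} (h : IsTestFunction Ω φ) (a : ℝ)
    (x : EPHSpace d) : HasGradientAt (fun x => a * φ x) (a • gradient φ x) x := by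
  rw [hasGradientAt_iff_hasFDerivAt, map_smul]
  exact (h.hasGradientAt x).hasFDerivAt.const_mul a

/-- Test functions are dense in `H¹₀`, so that a closed property of pairs (function, gradient)
needs to be checked for test functions only. -/
lemma H10.mem_of_isClosed {A : Set (EPHPair Ω)} (hA : IsClosed A)
    (h : ∀ φ (hφ : IsTestFunction Ω φ), testPair Ω hφ ∈ A) (w : H10 Ω) : (w : EPHPair Ω) ∈ A := by
  -- The test functions already form a vector space, so passing to the span adds nothing.
  have hspan : ∀ w ∈ Submodule.span ℝ {w : EPHPair Ω | ∃ φ : EPHSpace d → ℝ, IsTestFunction Ω φ ∧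
    (w.fst : EPHSpace d → ℝ) =ᵐ[volume.restrict Ω] φ ∧
    (w.snd : EPHSpace d → EPHSpace d) =ᵐ[volume.restrict Ω] gradient φ},
      ∃ φ : EPHSpace d → ℝ, IsTestFunction Ω φ ∧
    (w.fst : EPHSpace d → ℝ) =ᵐ[volume.restrict Ω] φ ∧
    (w.snd : EPHSpace d → EPHSpace d) =ᵐ[volume.restrict Ω] gradient φ := by
    intro w hw
    induction hw using Submodule.span_induction with
    | mem w hw => exact hw
    | zero =>
      refine ⟨fun _ => 0, IsTestFunction.zero, Lp.coeFn_zero _ _ _, ?_⟩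
      refine (Lp.coeFn_zero _ _ _).trans (Eventually.of_forall fun x => ?_)
      simp [gradient_fun_const]
    | add v w _ _ hv hw =>
      obtain ⟨φ, hφ, h1, h2⟩ := hv
      obtain ⟨ψ, hψ, h3, h4⟩ := hw
      refine ⟨_, hφ.add hψ, ?_, ?_⟩
      · filter_upwards [h1, h3, Lp.coeFn_add v.fst w.fst] with x a b c
        rw [WithLp.add_fst, c, Pi.add_apply, a, b]
      · filter_upwards [h2, h4, Lp.coeFn_add v.snd w.snd] with x a b c
        rw [WithLp.add_snd, c, Pi.add_apply, a, b]
        exact (hφ.hasGradientAt_add hψ x).gradient.symm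
    | smul a w _ hw =>
      obtain ⟨φ, hφ, h1, h2⟩ := hw
      refine ⟨_, hφ.smul a, ?_, ?_⟩
      · filter_upwards [h1, Lp.coeFn_smul a w.fst] with x a b
        rw [WithLp.smul_fst, b, Pi.smul_apply, a, smul_eq_mul]
      · filter_upwards [h2, Lp.coeFn_smul a w.snd] with x h b
        rw [WithLp.smul_snd, b, Pi.smul_apply, h]
        exact (hφ.hasGradientAt_smul a x).gradient.symm
  refine closure_minimal (fun v hv => ?_) hA w.2
  obtain ⟨φ, hφ, h1, h2⟩ := hspan v hv
  rw [eq_testPair hφ h1 h2]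
  exact h φ hφ

end Sobolev

/-- A `C¹` function that vanishes at the origin and whose derivative is bounded by `M`. -/
structure BoundedC1 (β : ℝ → ℝ) (M : ℝ) : Prop where
  contDiff : ContDiff ℝ 1 β
  zero : β 0 = 0
  bound : ∀ x, |deriv β x| ≤ M

/-! ### Calculus of C¹ functions with bounded derivative. -/

namespace BoundedC1

variable {β : ℝ → ℝ} {M : ℝ}

lemma nonneg (h : BoundedC1 β M) : 0 ≤ M := (abs_nonneg _).trans (h.bound 0)

lemma lipschitz (h : BoundedC1 β M) : LipschitzWith M.toNNReal β := by
  refine lipschitzWith_of_nnnorm_deriv_le (h.contDiff.differentiable (by simp)) fun x => ?_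
  rw [← NNReal.coe_le_coe, Real.coe_toNNReal _ h.nonneg]
  exact h.bound x

lemma abs_sub_le (h : BoundedC1 β M) (x y : ℝ) : |β x - β y| ≤ M * |x - y| := by
  have := h.lipschitz.dist_le_mul x y
  rwa [Real.coe_toNNReal _ h.nonneg] at this

lemma abs_le (h : BoundedC1 β M) (x : ℝ) : |β x| ≤ M * |x| := by
  simpa [h.zero] using h.abs_sub_le x 0

lemma continuous_deriv (h : BoundedC1 β M) : Continuous (deriv β) :=
  h.contDiff.continuous_deriv le_rfl

lemma comp {γ : ℝ → ℝ} {N : ℝ} (hγ : BoundedC1 γ N) (h : BoundedC1 β M) :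
    BoundedC1 (fun x => γ (β x)) (N * M) where
  contDiff := hγ.contDiff.comp h.contDiff
  zero := by rw [h.zero, hγ.zero]
  bound x := by
    have e : deriv (fun x => γ (β x)) x = deriv γ (β x) * deriv β x :=
      deriv_comp x (hγ.contDiff.differentiable (by simp) _) (h.contDiff.differentiable (by simp) _)
    rw [e, abs_mul]
    exact mul_le_mul (hγ.bound _) (h.bound _) (abs_nonneg _) hγ.nonneg

lemma of_integral {f : ℝ → ℝ} (hf : Continuous f) (hM : ∀ x, |f x| ≤ M) :
    BoundedC1 (fun t => ∫ x in (0 : ℝ)..t, f x) M := by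
  have hd : ∀ t, HasDerivAt (fun t => ∫ x in (0 : ℝ)..t, f x) (f t) t :=
    fun t => (hf.integral_hasStrictDerivAt 0 t).hasDerivAt
  have hd' : deriv (fun t => ∫ x in (0 : ℝ)..t, f x) = f := funext fun t => (hd t).deriv
  refine ⟨contDiff_one_iff_deriv.2 ⟨fun t => (hd t).differentiableAt, by rwa [hd']⟩, by simp, ?_⟩
  rwa [hd']

end BoundedC1

/-! ### Chain rule in H¹₀. -/

section ChainRule

variable {d : ℕ} {Ω : Set (EPHSpace d)} {β : ℝ → ℝ} {M : ℝ}

/-- `w ↦ β(w)` on `L²`. -/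
def BoundedC1.compL2 (h : BoundedC1 β M) (f : EPHL2 Ω) : EPHL2 Ω := h.lipschitz.compLp h.zero f

lemma BoundedC1.coeFn_compL2 (h : BoundedC1 β M) (f : EPHL2 Ω) :
    ∀ᵐ x ∂volume.restrict Ω, h.compL2 f x = β (f x) := h.lipschitz.coeFn_compLp h.zero f

lemma BoundedC1.continuous_compL2 (h : BoundedC1 β M) :
    Continuous (h.compL2 : EPHL2 Ω → EPHL2 Ω) := h.lipschitz.continuous_compLp h.zero

/-- `(w, ∇w) ↦ (β(w), β'(w)∇w)`. -/
def BoundedC1.compPair (h : BoundedC1 β M) (w : EPHPair Ω) : EPHPair Ω :=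
  WithLp.toLp 2 (h.compL2 w.fst, bddCompSmul h.continuous_deriv h.bound w.fst w.snd)

lemma BoundedC1.continuous_compPair (h : BoundedC1 β M) :
    Continuous (h.compPair : EPHPair Ω → EPHPair Ω) := by
  have h1 : Continuous fun w : EPHPair Ω => (w.fst, w.snd) := by fun_prop
  have h2 : Continuous fun w : EPHPair Ω => h.compL2 w.fst := h.continuous_compL2.comp (by fun_prop)
  have h3 : Continuous fun w : EPHPair Ω =>
      bddCompSmul h.continuous_deriv h.bound w.fst w.snd :=
    (continuous_bddCompSmul h.continuous_deriv h.bound).comp h1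
  exact (WithLp.prod_continuous_toLp 2 _ _).comp (h2.prodMk h3)

lemma IsTestFunction.comp {φ : EPHSpace d → ℝ} (hφ : IsTestFunction Ω φ) {γ : ℝ → ℝ}
    (hγ : ContDiff ℝ ∞ γ) (h0 : γ 0 = 0) : IsTestFunction Ω (fun x => γ (φ x)) :=
  ⟨hγ.comp hφ.1, hφ.2.1.comp_left h0, (tsupport_comp_subset h0 φ).trans hφ.2.2⟩

lemma IsTestFunction.gradient_comp {φ : EPHSpace d → ℝ} (hφ : IsTestFunction Ω φ) {γ : ℝ → ℝ}
    {γ' : ℝ} {x : EPHSpace d} (hγ : HasDerivAt γ γ' (φ x)) :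
    gradient (fun x => γ (φ x)) x = γ' • gradient φ x := by
  refine HasGradientAt.gradient ?_
  rw [hasGradientAt_iff_hasFDerivAt, map_smul]
  exact hγ.comp_hasFDerivAt x (hφ.hasGradientAt x).hasFDerivAt

lemma WithLp.norm_le_of_fst_snd_le {X Y : Type*} [SeminormedAddCommGroup X]
    [SeminormedAddCommGroup Y] {v w : WithLp 2 (X × Y)} {c : ℝ} (hc : 0 ≤ c)
    (h1 : ‖v.fst‖ ≤ c * ‖w.fst‖) (h2 : ‖v.snd‖ ≤ c * ‖w.snd‖) : ‖v‖ ≤ c * ‖w‖ := by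
  refine abs_le_of_sq_le_sq' ?_ (by positivity) |>.2
  rw [mul_pow, WithLp.prod_norm_sq_eq_of_L2, WithLp.prod_norm_sq_eq_of_L2, mul_add, ← mul_pow,
    ← mul_pow]
  gcongr

/-- The chain rule: `H¹₀` is stable under `BoundedC1` functions. -/
theorem BoundedC1.compPair_mem (h : BoundedC1 β M) (w : H10 Ω) :
    h.compPair (w : EPHPair Ω) ∈ H10Submodule Ω := by
  have hcl : IsClosed (H10Submodule Ω : Set (EPHPair Ω)) :=
    Submodule.isClosed_topologicalClosure _
  refine H10.mem_of_isClosed (A := h.compPair ⁻¹' (H10Submodule Ω : Set (EPHPair Ω)))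
    (hcl.preimage h.continuous_compPair) (fun φ hφ => ?_) w
  rw [mem_preimage, ← hcl.closure_eq, Metric.mem_closure_iff]
  intro ε hε
  set w := testPair Ω hφ
  obtain ⟨δ, hδ, hδε⟩ : ∃ δ : ℝ, 0 < δ ∧ δ * ‖w‖ < ε := by
    refine ⟨ε / (‖w‖ + 1), by positivity, ?_⟩
    rw [div_mul_eq_mul_div, div_lt_iff₀ (by positivity)]
    nlinarith [norm_nonneg w]
  -- Approximating β' uniformly within δ by a smooth g, the primitive of g composed with φ is a test
  -- function. The error is a composition with a function of slope at most δ, hence has H¹ norm at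
  -- most δ‖w‖.
  obtain ⟨g, hg, hgδ, -⟩ := h.continuous_deriv.exists_contDiff_approx (ε := fun _ => δ) ⊤
    continuous_const (fun _ => hδ)
  have hgs : ContDiff ℝ ∞ fun t => ∫ x in (0 : ℝ)..t, g x := ContDiff.integral_right hg 0
  have hgd : ∀ t, HasDerivAt (fun t => ∫ x in (0 : ℝ)..t, g x) (g t) t :=
    fun t => (hg.continuous.integral_hasStrictDerivAt 0 t).hasDerivAt
  have hdiff : BoundedC1 (fun t => β t - ∫ x in (0 : ℝ)..t, g x) δ := by
    refine ⟨h.contDiff.sub (hgs.of_le (by simp)), by simp [h.zero], fun x => ?_⟩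
    have : deriv (fun t => β t - ∫ x in (0 : ℝ)..t, g x) x = deriv β x - g x :=
      ((h.contDiff.differentiable (by simp) x).hasDerivAt.sub (hgd x)).deriv
    rw [this, abs_sub_comm]
    exact (hgδ x).le
  have ht := hφ.comp hgs (by simp)
  refine ⟨testPair Ω ht, testPair_mem ht, ?_⟩
  rw [dist_eq_norm]
  refine lt_of_le_of_lt (WithLp.norm_le_of_fst_snd_le (w := w) hδ.le ?_ ?_) hδε
  · refine Lp.norm_le_mul_norm_of_ae_le_mul ?_
    filter_upwards [Lp.coeFn_sub (h.compPair w).fst (testPair Ω ht).fst, h.coeFn_compL2 w.fst,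
      coeFn_testPair_fst ht, coeFn_testPair_fst hφ] with x h1 h2 h3 h4
    have e : (h.compPair w - testPair Ω ht).fst x = β (w.fst x) - ∫ y in (0 : ℝ)..(φ x), g y := by
      rw [WithLp.sub_fst, h1, Pi.sub_apply, h3, ← h2]; rfl
    rw [e, ← h4]
    exact hdiff.abs_le _
  · refine Lp.norm_le_mul_norm_of_ae_le_mul ?_
    filter_upwards [Lp.coeFn_sub (h.compPair w).snd (testPair Ω ht).snd,
      coeFn_bddCompSmul h.continuous_deriv h.bound w.fst w.snd,
      coeFn_testPair_snd ht, coeFn_testPair_fst hφ, coeFn_testPair_snd hφ] with x h1 h2 h3 h4 h5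
    have e : (h.compPair w - testPair Ω ht).snd x = (deriv β (w.fst x) - g (w.fst x)) • w.snd x := by
      rw [WithLp.sub_snd, h1, Pi.sub_apply, h3, hφ.gradient_comp (hgd (φ x)), sub_smul, ← h2, h4, h5]
      rfl
    rw [e, norm_smul, Real.norm_eq_abs, abs_sub_comm]
    exact mul_le_mul_of_nonneg_right (hgδ _).le (norm_nonneg _)

/-- `w ↦ β(w)` on `H¹₀`. -/
def BoundedC1.compH10 (h : BoundedC1 β M) (w : H10 Ω) : H10 Ω :=
  ⟨h.compPair (w : EPHPair Ω), h.compPair_mem w⟩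

lemma BoundedC1.continuous_compH10 (h : BoundedC1 β M) :
    Continuous (h.compH10 : H10 Ω → H10 Ω) :=
  (h.continuous_compPair.comp continuous_subtype_val).subtype_mk _

lemma BoundedC1.fn_compH10 (h : BoundedC1 β M) (w : H10 Ω) :
    H10.fn (h.compH10 w) = h.compL2 (H10.fn w) := rfl

lemma BoundedC1.coeFn_grad_compH10 (h : BoundedC1 β M) (w : H10 Ω) :
    ∀ᵐ x ∂volume.restrict Ω,
      H10.grad (h.compH10 w) x = deriv β (H10.fn w x) • H10.grad w x :=
  coeFn_bddCompSmul h.continuous_deriv h.bound _ _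

lemma BoundedC1.norm_compH10_le (h : BoundedC1 β M) (w : H10 Ω) :
    ‖h.compH10 w‖ ≤ M * ‖w‖ := by
  refine WithLp.norm_le_of_fst_snd_le (v := (h.compH10 w : EPHPair Ω)) (w := (w : EPHPair Ω))
    h.nonneg ?_ (norm_bddCompSmul_le h.continuous_deriv h.bound _ _)
  refine Lp.norm_le_mul_norm_of_ae_le_mul ?_
  filter_upwards [h.coeFn_compL2 (H10.fn w)] with x hx
  rw [← H10.fn, h.fn_compH10, hx]
  exact h.abs_le _

end ChainRule

/-! ### The gradient in H¹₀ is determined by the function. -/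

section Uniqueness

variable {d : ℕ} {Ω : Set (EPHSpace d)}

/-- The function underlying an element of `H¹₀`, as a continuous linear map. -/
def H10.fnL (Ω : Set (EPHSpace d)) : H10 Ω →L[ℝ] EPHL2 Ω :=
  (WithLp.fstL 2 ℝ (EPHL2 Ω) (EPHL2Vec Ω)).comp (H10Submodule Ω).subtypeL

lemma H10.fnL_apply (w : H10 Ω) : H10.fnL Ω w = H10.fn w := rfl

/-- The gradient as a continuous linear map on `H¹₀`. -/
def H10.gradL (Ω : Set (EPHSpace d)) : H10 Ω →L[ℝ] EPHL2Vec Ω :=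
  (WithLp.sndL 2 ℝ (EPHL2 Ω) (EPHL2Vec Ω)).comp (H10Submodule Ω).subtypeL

lemma H10.norm_sq (w : H10 Ω) : ‖w‖ ^ 2 = ‖H10.fn w‖ ^ 2 + ‖H10.grad w‖ ^ 2 :=
  WithLp.prod_norm_sq_eq_of_L2 (w : EPHPair Ω)

/-- Integration by parts between elements of `H¹₀` and test functions. -/
lemma H10.inner_fn_eq_neg_inner_grad {φ : EPHSpace d → ℝ} (hφ : IsTestFunction Ω φ) (j : Fin d)
    {a : EPHL2 Ω} {c : EPHL2Vec Ω} (ha : a =ᵐ[volume.restrict Ω] fun x => gradient φ x j)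
    (hc : c =ᵐ[volume.restrict Ω] fun x => φ x • EuclideanSpace.single j (1 : ℝ)) (w : H10 Ω) :
    inner ℝ a (H10.fn w) = -inner ℝ c (H10.grad w) := by
  have hcl : IsClosed {w : EPHPair Ω | inner ℝ a w.fst = -inner ℝ c w.snd} :=
    isClosed_eq (by fun_prop) (by fun_prop)
  refine H10.mem_of_isClosed hcl (fun ψ hψ => ?_) w
  rw [mem_ofPred_eq, L2.inner_def, L2.inner_def]
  have hz : ∀ F : EPHSpace d → ℝ, (∀ x, x ∉ Ω → F x = 0) → ∫ x in Ω, F x = ∫ x, F x :=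
    fun F hF => setIntegral_eq_integral_of_forall_compl_eq_zero hF
  have e1 : ∫ x in Ω, inner ℝ (a x) ((testPair Ω hψ).fst x) = ∫ x, ψ x * fderiv ℝ φ x (EuclideanSpace.single j 1) := by
    rw [← hz _ fun x hx => by
      rw [image_eq_zero_of_notMem_tsupport fun h => hx (hψ.2.2 h), zero_mul]]
    refine integral_congr_ae ?_
    filter_upwards [ha, coeFn_testPair_fst hψ] with x h1 h2
    rw [h1, h2, (hφ.hasGradientAt x).fderiv_apply]
    simp [EuclideanSpace.inner_single_right, -inner_gradient_left]
  have e2 : ∫ x in Ω, inner ℝ (c x) ((testPair Ω hψ).snd x) = ∫ x, fderiv ℝ ψ x (EuclideanSpace.single j 1) * φ x := by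
    rw [← hz _ fun x hx => by
      rw [image_eq_zero_of_notMem_tsupport fun h => hx (hφ.2.2 h), mul_zero]]
    refine integral_congr_ae ?_
    filter_upwards [hc, coeFn_testPair_snd hψ] with x h1 h2
    rw [h1, h2, (hψ.hasGradientAt x).fderiv_apply, inner_smul_left, mul_comm, real_inner_comm]
    simp
  rw [e1, e2]
  have c1 : ∀ {χ : EPHSpace d → ℝ}, IsTestFunction Ω χ →
      Continuous fun x => fderiv ℝ χ x (EuclideanSpace.single j 1) := fun hχ =>
    (hχ.1.continuous_fderiv (by simp)).clm_apply continuous_const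
  refine integral_mul_fderiv_eq_neg_fderiv_mul_of_integrable ?_ ?_ ?_
    (fun x _ => hψ.1.differentiable (by simp) x) (fun x _ => hφ.1.differentiable (by simp) x)
  · exact ((c1 hψ).mul hφ.1.continuous).integrable_of_hasCompactSupport hφ.2.1.mul_left
  · exact (hψ.1.continuous.mul (c1 hφ)).integrable_of_hasCompactSupport hψ.2.1.mul_right
  · exact (hψ.1.continuous.mul hφ.1.continuous).integrable_of_hasCompactSupport hφ.2.1.mul_left

/-- An element of `H¹₀` is determined by its function part. -/
theorem H10.fn_injective [IsFiniteMeasure (volume.restrict Ω)] (hΩ : IsOpen Ω) : Function.Injective (H10.fn : H10 Ω → EPHL2 Ω) := by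
  suffices h : ∀ w : H10 Ω, H10.fn w = 0 → w = 0 by
    intro v w hvw
    rw [← sub_eq_zero]
    refine h _ ?_
    rw [← H10.fnL_apply, map_sub, H10.fnL_apply, H10.fnL_apply, hvw, sub_self]
  intro w hw
  -- Integration by parts against test functions shows that each component of the gradient
  -- integrates to zero against all of C_c^∞(Ω).
  have hg : H10.grad w = 0 := by
    have hj : ∀ j : Fin d, ∀ᵐ x ∂volume, x ∈ Ω → H10.grad w x j = 0 := by
      intro j
      refine hΩ.ae_eq_zero_of_integral_contDiff_smul_eq_zero ?_ ?_
      · have h1 : Integrable (H10.grad w) (volume.restrict Ω) :=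
          (Lp.memLp (H10.grad w)).integrable (by norm_num)
        have h2 : IntegrableOn (fun x => H10.grad w x j) Ω :=
          (EuclideanSpace.proj (𝕜 := ℝ) j).integrable_comp h1
        exact h2.locallyIntegrableOn
      · intro φ h1 h2 h3
        have hφ : IsTestFunction Ω φ := ⟨h1, h2, h3⟩
        have m1 : MemLp (fun x => gradient φ x j) 2 (volume.restrict Ω) := by
          refine MemLp.restrict Ω (Continuous.memLp_of_hasCompactSupport ?_ ?_)
          · exact (EuclideanSpace.proj (𝕜 := ℝ) j).continuous.comp (continuous_gradient h1)
          · exact h2.gradient.comp_left (g := EuclideanSpace.proj (𝕜 := ℝ) j) (by simp)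
        have m2 : MemLp (fun x => φ x • EuclideanSpace.single j (1 : ℝ)) 2 (volume.restrict Ω) := by
          refine MemLp.restrict Ω (Continuous.memLp_of_hasCompactSupport ?_ h2.smul_right)
          exact h1.continuous.smul continuous_const
        have := H10.inner_fn_eq_neg_inner_grad hφ j m1.coeFn_toLp m2.coeFn_toLp w
        rw [hw, inner_zero_right, eq_comm, neg_eq_zero, L2.inner_def] at this
        rw [← setIntegral_eq_integral_of_forall_compl_eq_zero (s := Ω) fun x hx => by
          rw [image_eq_zero_of_notMem_tsupport fun h => hx (h3 h), zero_smul], ← this]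
        refine integral_congr_ae ?_
        filter_upwards [m2.coeFn_toLp] with x hx
        rw [hx, inner_smul_left]
        simp [EuclideanSpace.inner_single_left]
    apply Lp.ext
    have := ae_all_iff.2 hj
    rw [Filter.EventuallyEq, ae_restrict_iff' hΩ.measurableSet]
    filter_upwards [this, (ae_restrict_iff' hΩ.measurableSet).1 (Lp.coeFn_zero (EPHSpace d) 2 (volume.restrict Ω))] with x hx h0 hm
    rw [h0 hm]
    ext j
    exact hx j hm
  have := H10.norm_sq w
  rw [hw, hg] at this
  simpa using this

end Uniqueness

/-- The properties of a single capillary pressure curve `pc` and the function `b`. -/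
structure ScanningCurve (b pc : ℝ → ℝ) : Prop where
  contDiff : ContDiff ℝ 1 b
  deriv_nonneg : ∀ p, 0 ≤ deriv b p
  pcContDiff : ContDiffOn ℝ 1 pc (Ioo 0 1)
  pcCont : ContinuousOn pc (Ioc 0 1)
  pcDeriv_neg : ∀ S ∈ Ioo (0 : ℝ) 1, deriv pc S < 0
  blowup : Tendsto pc (𝓝[>] 0) atTop
  bound : ∀ S ∈ Ioo (0 : ℝ) 1, 0 < deriv b (pc S) ∧ deriv b (pc S) < -1 / deriv pc S

lemma ScanningFunction.curveI {pcI pcD b : ℝ → ℝ} (hb : ScanningFunction pcI pcD b)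
    (hpc : CapillaryCurves pcI pcD) : ScanningCurve b pcI :=
  ⟨hb.contDiff, hb.deriv_nonneg, hpc.contDiffI, hpc.contI, hpc.derivI_neg, hpc.blowupI, hb.boundI⟩

lemma ScanningFunction.curveD {pcI pcD b : ℝ → ℝ} (hb : ScanningFunction pcI pcD b)
    (hpc : CapillaryCurves pcI pcD) : ScanningCurve b pcD :=
  ⟨hb.contDiff, hb.deriv_nonneg, hpc.contDiffD, hpc.contD, hpc.derivD_neg, hpc.blowupD, hb.boundD⟩

/-! ### The capillary curves as graphs u = ρ(v). -/

namespace ScanningCurve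

variable {b pc : ℝ → ℝ}

lemma monotone (h : ScanningCurve b pc) : Monotone b :=
  monotone_of_deriv_nonneg (h.contDiff.differentiable (by simp)) h.deriv_nonneg

lemma hasDerivAt_comp (h : ScanningCurve b pc) {S : ℝ} (hS : S ∈ Ioo (0 : ℝ) 1) :
    HasDerivAt (fun S => b (pc S)) (deriv b (pc S) * deriv pc S) S :=
  (h.contDiff.differentiable (by simp) (pc S)).hasDerivAt.comp S
    (((h.pcContDiff.differentiableOn (by simp)).differentiableAt (isOpen_Ioo.mem_nhds hS)).hasDerivAt)

lemma pc_strictAntiOn (h : ScanningCurve b pc) : StrictAntiOn pc (Ioc 0 1) :=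
  strictAntiOn_of_deriv_neg (convex_Ioc 0 1) h.pcCont (by rw [interior_Ioc]; exact h.pcDeriv_neg)

lemma continuousOn_comp (h : ScanningCurve b pc) : ContinuousOn (fun S => b (pc S)) (Ioc 0 1) :=
  h.contDiff.continuous.comp_continuousOn h.pcCont

lemma comp_strictAntiOn (h : ScanningCurve b pc) : StrictAntiOn (fun S => b (pc S)) (Ioc 0 1) := by
  refine strictAntiOn_of_deriv_neg (convex_Ioc 0 1) h.continuousOn_comp ?_
  rw [interior_Ioc]
  intro S hS
  rw [(h.hasDerivAt_comp hS).deriv]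
  exact mul_neg_of_pos_of_neg (h.bound S hS).1 (h.pcDeriv_neg S hS)

/-- The bound b' < -1/pc' along the curve says exactly that 1 + b'(pc)pc' > 0; this makes v a
coordinate on the curve. -/
lemma strictMonoOn (h : ScanningCurve b pc) : StrictMonoOn (fun S => S + b (pc S)) (Ioc 0 1) := by
  refine strictMonoOn_of_deriv_pos (convex_Ioc 0 1) (continuousOn_id.add h.continuousOn_comp) ?_
  rw [interior_Ioc]
  intro S hS
  have e : deriv (fun S => S + b (pc S)) S = 1 + deriv b (pc S) * deriv pc S :=
    ((hasDerivAt_id' S).add (h.hasDerivAt_comp hS)).deriv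
  rw [e]
  have h1 := h.pcDeriv_neg S hS
  have h2 := (h.bound S hS).2
  rw [lt_div_iff_of_neg h1] at h2
  linarith

lemma exists_pc_ge (h : ScanningCurve b pc) (x : ℝ) {δ : ℝ} (hδ : 0 < δ) :
    ∃ S ∈ Ioo 0 δ, x ≤ pc S := by
  have := (h.blowup.eventually_ge_atTop x).and (Ioo_mem_nhdsGT hδ)
  obtain ⟨S, h1, h2⟩ := this.exists
  exact ⟨S, h2, h1⟩

/-- Since pc blows up at 0, every x lies below some pc(S), and b(pc(S)) < 1 + b(pc(1)) by
monotonicity of S + b(pc(S)). So b is bounded above and the limit defining `bInfty` really exists.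
-/
lemma tendsto_bInfty (h : ScanningCurve b pc) : Tendsto b atTop (𝓝 (bInfty b)) := by
  have hbdd : BddAbove (range b) := by
    refine ⟨1 + b (pc 1), ?_⟩
    rintro _ ⟨x, rfl⟩
    obtain ⟨S, hS, hx⟩ := h.exists_pc_ge x one_pos
    have h1 := h.strictMonoOn ⟨hS.1, hS.2.le⟩ ⟨one_pos, le_rfl⟩ hS.2
    have h2 := h.monotone hx
    simp only at h1
    linarith [hS.1]
  have := tendsto_atTop_ciSup h.monotone hbdd
  rw [bInfty, this.limUnder_eq]
  exact this

lemma le_bInfty (h : ScanningCurve b pc) (x : ℝ) : b x ≤ bInfty b :=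
  h.monotone.ge_of_tendsto h.tendsto_bInfty x

lemma tendsto_zero (h : ScanningCurve b pc) :
    Tendsto (fun S => S + b (pc S)) (𝓝[>] 0) (𝓝 (bInfty b)) := by
  have h1 : Tendsto (fun S : ℝ => S) (𝓝[>] 0) (𝓝 0) := tendsto_nhdsWithin_of_tendsto_nhds tendsto_id
  simpa using h1.add (h.tendsto_bInfty.comp h.blowup)

/-- Passing to the limit S → 0 loses strictness; comparing with S/2 restores it. -/
lemma bInfty_lt (h : ScanningCurve b pc) {S : ℝ} (hS : S ∈ Ioc (0 : ℝ) 1) :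
    bInfty b < S + b (pc S) := by
  have hS2 : S / 2 ∈ Ioc (0 : ℝ) 1 := ⟨by linarith [hS.1], by linarith [hS.1, hS.2]⟩
  have h1 : bInfty b ≤ S / 2 + b (pc (S / 2)) := by
    refine le_of_tendsto h.tendsto_zero ?_
    filter_upwards [Ioo_mem_nhdsGT hS2.1] with x hx
    exact (h.strictMonoOn ⟨hx.1, hx.2.le.trans hS2.2⟩ hS2 hx.2).le
  exact h1.trans_lt (h.strictMonoOn hS2 hS (by linarith [hS.1]))

lemma comp_lt_bInfty (h : ScanningCurve b pc) {S : ℝ} (hS : S ∈ Ioc (0 : ℝ) 1) :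
    b (pc S) < bInfty b := by
  have hS2 : S / 2 ∈ Ioc (0 : ℝ) 1 := ⟨by linarith [hS.1], by linarith [hS.1, hS.2]⟩
  exact (h.comp_strictAntiOn hS2 hS (by linarith [hS.1])).trans_le (h.le_bInfty _)

lemma rho_of_le {v : ℝ} (hv : v ≤ bInfty b) : rho b pc v = bInfty b := if_pos hv

lemma rho_of_ge (h : ScanningCurve b pc) {v : ℝ} (hv : 1 + b (pc 1) ≤ v) :
    rho b pc v = b (pc 1) := by
  have h1 := h.bInfty_lt (S := 1) ⟨one_pos, le_rfl⟩
  rw [rho, if_neg (by linarith), if_pos hv]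

lemma rho_apply (h : ScanningCurve b pc) {S : ℝ} (hS : S ∈ Ioo (0 : ℝ) 1) :
    rho b pc (S + b (pc S)) = b (pc S) := by
  have hS' : S ∈ Ioc (0 : ℝ) 1 := ⟨hS.1, hS.2.le⟩
  have h1 := h.bInfty_lt hS'
  have h2 := h.strictMonoOn hS' ⟨one_pos, le_rfl⟩ hS.2
  have hinj : InjOn (fun S => S + b (pc S)) (Ioo 0 1) :=
    (h.strictMonoOn.mono Ioo_subset_Ioc_self).injOn
  rw [rho, if_neg (by linarith), if_neg (by simpa using h2)]
  have : Function.invFunOn (fun S => S + b (pc S)) (Ioo 0 1) (S + b (pc S)) = S :=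
    hinj.leftInvOn_invFunOn hS
  rw [this]

lemma exists_solution (h : ScanningCurve b pc) {v : ℝ} (h1 : bInfty b < v)
    (h2 : v < 1 + b (pc 1)) : ∃ S ∈ Ioo (0 : ℝ) 1, S + b (pc S) = v := by
  obtain ⟨S, hS1, hS⟩ := ((h.tendsto_zero.eventually_lt_const h1).and (Ioo_mem_nhdsGT one_pos)).exists
  have hc : ContinuousOn (fun S => S + b (pc S)) (Icc S 1) :=
    (continuousOn_id.add h.continuousOn_comp).mono fun x hx => ⟨hS.1.trans_le hx.1, hx.2⟩
  obtain ⟨S', hS', e⟩ := intermediate_value_Ioo hS.2.le hc ⟨hS1, h2⟩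
  exact ⟨S', ⟨hS.1.trans hS'.1, hS'.2⟩, e⟩

/-- The three branches of `rho`. -/
lemma rho_cases (h : ScanningCurve b pc) (v : ℝ) :
    v ≤ bInfty b ∨ 1 + b (pc 1) ≤ v ∨ ∃ S ∈ Ioo (0 : ℝ) 1, S + b (pc S) = v := by
  rcases le_or_gt v (bInfty b) with h1 | h1
  · exact Or.inl h1
  rcases le_or_gt (1 + b (pc 1)) v with h2 | h2
  · exact Or.inr (Or.inl h2)
  exact Or.inr (Or.inr (h.exists_solution h1 h2))

lemma rho_mem (h : ScanningCurve b pc) (v : ℝ) : rho b pc v ∈ Icc (b (pc 1)) (bInfty b) := by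
  rcases h.rho_cases v with hv | hv | ⟨S, hS, rfl⟩
  · rw [rho_of_le hv]; exact ⟨h.le_bInfty _, le_rfl⟩
  · rw [h.rho_of_ge hv]; exact ⟨le_rfl, h.le_bInfty _⟩
  · rw [h.rho_apply hS]
    exact ⟨(h.comp_strictAntiOn ⟨hS.1, hS.2.le⟩ ⟨one_pos, le_rfl⟩ hS.2).le, h.le_bInfty _⟩

lemma rho_antitone (h : ScanningCurve b pc) : Antitone (rho b pc) := by
  intro v w hvw
  rcases h.rho_cases v with hv | hv | ⟨S, hS, rfl⟩
  · rw [rho_of_le hv]; exact (h.rho_mem w).2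
  · rw [h.rho_of_ge hv, h.rho_of_ge (hv.trans hvw)]
  · rcases h.rho_cases w with hw | hw | ⟨S', hS', rfl⟩
    · exact absurd (hvw.trans hw) (not_le.2 (h.bInfty_lt ⟨hS.1, hS.2.le⟩))
    · rw [h.rho_of_ge hw]; exact (h.rho_mem _).1
    · rw [h.rho_apply hS, h.rho_apply hS']
      have : S ≤ S' := (h.strictMonoOn.le_iff_le ⟨hS.1, hS.2.le⟩ ⟨hS'.1, hS'.2.le⟩).1 hvw
      exact h.comp_strictAntiOn.antitoneOn ⟨hS.1, hS.2.le⟩ ⟨hS'.1, hS'.2.le⟩ this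

/-- The saturation on the capillary curve as a function of `v`. -/
def sat (b pc : ℝ → ℝ) (v : ℝ) : ℝ := max (bInfty b) (min v (1 + b (pc 1))) - rho b pc v

lemma bInfty_lt_top (h : ScanningCurve b pc) : bInfty b < 1 + b (pc 1) :=
  h.bInfty_lt (S := 1) ⟨one_pos, le_rfl⟩

lemma sat_of_le (h : ScanningCurve b pc) {v : ℝ} (hv : v ≤ bInfty b) : sat b pc v = 0 := by
  rw [sat, rho_of_le hv, min_eq_left (hv.trans h.bInfty_lt_top.le), max_eq_left hv, sub_self]

lemma sat_of_ge (h : ScanningCurve b pc) {v : ℝ} (hv : 1 + b (pc 1) ≤ v) : sat b pc v = 1 := by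
  rw [sat, h.rho_of_ge hv, min_eq_right hv, max_eq_right h.bInfty_lt_top.le]; ring

lemma sat_apply (h : ScanningCurve b pc) {S : ℝ} (hS : S ∈ Ioo (0 : ℝ) 1) :
    sat b pc (S + b (pc S)) = S := by
  have h2 := h.strictMonoOn ⟨hS.1, hS.2.le⟩ ⟨one_pos, le_rfl⟩ hS.2
  rw [sat, h.rho_apply hS, min_eq_left h2.le, max_eq_right (h.bInfty_lt ⟨hS.1, hS.2.le⟩).le]
  ring

lemma sat_mem (h : ScanningCurve b pc) (v : ℝ) : sat b pc v ∈ Icc (0 : ℝ) 1 := by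
  rcases h.rho_cases v with hv | hv | ⟨S, hS, rfl⟩
  · rw [h.sat_of_le hv]; simp
  · rw [h.sat_of_ge hv]; simp
  · rw [h.sat_apply hS]; exact ⟨hS.1.le, hS.2.le⟩

lemma sat_monotone (h : ScanningCurve b pc) : Monotone (sat b pc) := by
  intro v w hvw
  rcases h.rho_cases v with hv | hv | ⟨S, hS, rfl⟩
  · rw [h.sat_of_le hv]; exact (h.sat_mem w).1
  · rw [h.sat_of_ge hv, h.sat_of_ge (hv.trans hvw)]
  · rcases h.rho_cases w with hw | hw | ⟨S', hS', rfl⟩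
    · exact absurd (hvw.trans hw) (not_le.2 (h.bInfty_lt ⟨hS.1, hS.2.le⟩))
    · rw [h.sat_of_ge hw]; exact (h.sat_mem _).2
    · rw [h.sat_apply hS, h.sat_apply hS']
      exact (h.strictMonoOn.le_iff_le ⟨hS.1, hS.2.le⟩ ⟨hS'.1, hS'.2.le⟩).1 hvw

/-- A monotone map onto the interval [0,1] has no jumps, so no inverse function argument is needed
at the endpoints. -/
lemma sat_continuous (h : ScanningCurve b pc) : Continuous (sat b pc) := by
  let f : ℝ → Icc (0 : ℝ) 1 := fun v => ⟨sat b pc v, h.sat_mem v⟩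
  have hm : Monotone f := fun v w hvw => h.sat_monotone hvw
  have hsurj : Function.Surjective f := by
    rintro ⟨s, hs⟩
    rcases hs.1.eq_or_lt with h0 | h0
    · exact ⟨bInfty b, Subtype.ext ((h.sat_of_le le_rfl).trans h0)⟩
    rcases hs.2.eq_or_lt with h1 | h1
    · exact ⟨1 + b (pc 1), Subtype.ext ((h.sat_of_ge le_rfl).trans h1.symm)⟩
    · exact ⟨s + b (pc s), Subtype.ext (h.sat_apply ⟨h0, h1⟩)⟩
  exact continuous_subtype_val.comp (hm.continuous_of_surjective hsurj)

lemma rho_continuous (h : ScanningCurve b pc) : Continuous (rho b pc) := by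
  have : rho b pc = fun v => max (bInfty b) (min v (1 + b (pc 1))) - sat b pc v := by
    funext v; rw [sat]; ring
  rw [this]
  exact (by fun_prop : Continuous fun v => max (bInfty b) (min v (1 + b (pc 1)))).sub h.sat_continuous

/-- Strictness matters: it lets the primitive of ψ∘ρ detect every v below the critical value when
the saturation is bounded from below. -/
lemma lt_rho_of_lt (h : ScanningCurve b pc) {S v : ℝ} (hS : S ∈ Ioo (0 : ℝ) 1)
    (hv : v < S + b (pc S)) : b (pc S) < rho b pc v := by
  rcases h.rho_cases v with hv' | hv' | ⟨S', hS', rfl⟩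
  · rw [rho_of_le hv']; exact h.comp_lt_bInfty ⟨hS.1, hS.2.le⟩
  · exact absurd (hv.trans (h.strictMonoOn ⟨hS.1, hS.2.le⟩ ⟨one_pos, le_rfl⟩ hS.2)) (not_lt.2 hv')
  · rw [h.rho_apply hS']
    have : S' < S := (h.strictMonoOn.lt_iff_lt ⟨hS'.1, hS'.2.le⟩ ⟨hS.1, hS.2.le⟩).1 hv
    exact h.comp_strictAntiOn ⟨hS'.1, hS'.2.le⟩ ⟨hS.1, hS.2.le⟩ this

lemma rho_le_of_ge (h : ScanningCurve b pc) {S v : ℝ} (hS : S ∈ Ioo (0 : ℝ) 1)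
    (hv : S + b (pc S) ≤ v) : rho b pc v ≤ b (pc S) :=
  (h.rho_antitone hv).trans_eq (h.rho_apply hS)

lemma abs_rho_le (h : ScanningCurve b pc) (v : ℝ) :
    |rho b pc v| ≤ |b (pc 1)| + |bInfty b| := by
  have h1 := h.rho_mem v
  rw [abs_le]
  have := neg_abs_le (b (pc 1))
  have := le_abs_self (bInfty b)
  have := abs_nonneg (b (pc 1))
  have := abs_nonneg (bInfty b)
  constructor <;> linarith [h1.1, h1.2]

end ScanningCurve

/-! ### Ordering of the curves and the sign of the hysteresis relation. -/

section Hysteresis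

variable {pcI pcD b : ℝ → ℝ}

/-- At equal S the imbibition curve has the smaller u, hence also the smaller v. As ρ_i is
nonincreasing, its value at the larger v is no larger than b(p_i(S)) ≤ b(p_d(S)). -/
lemma rho_imbibition_le_drainage (hpc : CapillaryCurves pcI pcD)
    (hb : ScanningFunction pcI pcD b) (v : ℝ) : rho b pcI v ≤ rho b pcD v := by
  have hI := hb.curveI hpc
  have hD := hb.curveD hpc
  rcases hD.rho_cases v with hv | hv | ⟨S, hS, rfl⟩
  · rw [ScanningCurve.rho_of_le (pc := pcD) hv]; exact (hI.rho_mem v).2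
  · rw [hD.rho_of_ge hv, hI.rho_of_ge (by rwa [hpc.eq_one]), hpc.eq_one]
  · rw [hD.rho_apply hS]
    refine hI.rho_le_of_ge hS ?_ |>.trans (hD.monotone (hpc.lt S hS).le)
    have := hD.monotone (hpc.lt S hS).le
    linarith

/-- The hysteresis relation dissipates: it has the opposite sign of `ψ(u) - ψ(ρ(v))`. -/
lemma PhiTau_mul_nonpos (hpc : CapillaryCurves pcI pcD) (hb : ScanningFunction pcI pcD b)
    {ψ : ℝ → ℝ} (hψ : Monotone ψ) {τ : ℝ} (hτ : 0 < τ) (u v : ℝ) :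
    PhiTau pcI pcD b τ u v * (ψ u - ψ (rho b pcD v)) ≤ 0 := by
  have h1 := rho_imbibition_le_drainage hpc hb v
  have h2 : 0 < 1 / τ := by positivity
  rw [PhiTau]
  split_ifs with h3 h4
  · have := hψ h3.le
    exact mul_nonpos_of_nonpos_of_nonneg
      (mul_nonpos_of_nonneg_of_nonpos h2.le (by linarith)) (by linarith)
  -- Below the imbibition curve u is also below the drainage curve, so comparison with ρ_d alone
  -- suffices for both branches.
  · have := hψ (h4.le.trans h1)
    exact mul_nonpos_of_nonneg_of_nonpos
      (mul_nonneg h2.le (by linarith)) (by linarith)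
  · simp

/-- As s → 0 the left side s + b(p_d(s)) tends to b(∞), which lies strictly below every point S +
b(p_i(S)). The condition p_d(s) ≥ 0 is kept so that the truncation level b(p_d(s)) is nonnegative.
-/
lemma exists_lower_saturation (hpc : CapillaryCurves pcI pcD) (hb : ScanningFunction pcI pcD b)
    {ε : ℝ} (hε : ε ∈ Ioo (0 : ℝ) 1) :
    ∃ s ∈ Ioo (0 : ℝ) 1, s ≤ ε ∧ 0 ≤ pcD s ∧ s + b (pcD s) ≤ ε + b (pcI ε) := by
  have hD := hb.curveD hpc
  have h1 := (hb.curveI hpc).bInfty_lt (S := ε) ⟨hε.1, hε.2.le⟩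
  obtain ⟨s, ⟨h2, h3⟩, h4⟩ := ((hD.tendsto_zero.eventually_lt_const h1).and
    (hD.blowup.eventually_ge_atTop 0)).and (Ioo_mem_nhdsGT hε.1) |>.exists
  exact ⟨s, ⟨h4.1, h4.2.trans hε.2⟩, h4.2.le, h3, h2.le⟩

end Hysteresis

/-! ### Convex integral functionals and their subgradients. -/

section ConvexFunctional

lemma integral_le_mul_sub_of_monotone {θ : ℝ → ℝ} (hθ : Monotone θ) (hc : Continuous θ) (x y : ℝ) :
    ∫ z in y..x, θ z ≤ θ x * (x - y) := by
  have hi : ∀ a b, IntervalIntegrable θ volume a b := fun a b => hc.intervalIntegrable a b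
  rcases le_total y x with h | h
  · calc ∫ z in y..x, θ z ≤ ∫ _ in y..x, θ x :=
          intervalIntegral.integral_mono_on h (hi _ _) (by simp) fun z hz => hθ hz.2
      _ = θ x * (x - y) := by simp [mul_comm]
  · rw [intervalIntegral.integral_symm]
    have : ∫ _ in x..y, θ x ≤ ∫ z in x..y, θ z :=
      intervalIntegral.integral_mono_on h (by simp) (hi _ _) fun z hz => hθ hz.1
    rw [intervalIntegral.integral_const, smul_eq_mul] at this
    linarith

variable {α : Type*} {m : MeasurableSpace α} {μ : Measure α}

/-- The functional `f ↦ ∫ Θ(f)` on `L²`, where `Θ` is the primitive of `θ` that vanishes at `a`. -/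
def primitiveFunctional (θ : ℝ → ℝ) (a : ℝ) (f : Lp ℝ 2 μ) : ℝ := ∫ x, (∫ y in a..f x, θ y) ∂μ

lemma primitiveFunctional_neg (θ : ℝ → ℝ) (a : ℝ) (f : Lp ℝ 2 μ) :
    primitiveFunctional (fun y => -θ y) a f = -primitiveFunctional θ a f := by
  simp [primitiveFunctional, integral_neg]

variable [IsFiniteMeasure μ] {θ : ℝ → ℝ} {N : Lp ℝ 2 μ → Lp ℝ 2 μ}

/-- The tangent inequalities at 0 and at f(x) trap the primitive from 0 to f(x) between θ(0)f and
θ(f)f; the latter is a product of two L² functions because N(f) = θ(f) is in L². -/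
lemma integrable_primitive (hθ : Monotone θ) (hc : Continuous θ)
    (hN : ∀ f, N f =ᵐ[μ] fun x => θ (f x)) (a : ℝ) (f : Lp ℝ 2 μ) :
    Integrable (fun x => ∫ y in a..f x, θ y) μ := by
  have hi : ∀ a b, IntervalIntegrable θ volume a b := fun a b => hc.intervalIntegrable a b
  have hf : MemLp f 2 μ := Lp.memLp f
  have h1 : Integrable (fun x => |N f x * f x| + |θ 0 * f x| + |∫ y in a..(0 : ℝ), θ y|) μ :=
    (((Lp.memLp (N f)).integrable_mul hf).abs.add
      ((hf.integrable (by norm_num)).const_mul (θ 0)).abs).add (integrable_const _)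
  refine h1.mono' ?_ ?_
  · have : Continuous fun t => ∫ y in a..t, θ y :=
      intervalIntegral.continuous_primitive (fun a b => hi a b) a
    exact this.comp_aestronglyMeasurable (Lp.aestronglyMeasurable f)
  · filter_upwards [hN f] with x hx
    rw [hx]
    have e : ∫ y in a..f x, θ y = (∫ y in a..(0 : ℝ), θ y) + ∫ y in (0 : ℝ)..f x, θ y :=
      (intervalIntegral.integral_add_adjacent_intervals (hi _ _) (hi _ _)).symm
    have h2 := integral_le_mul_sub_of_monotone hθ hc (f x) 0
    have h3 := integral_le_mul_sub_of_monotone hθ hc 0 (f x)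
    rw [intervalIntegral.integral_symm] at h3
    rw [Real.norm_eq_abs, e, abs_le]
    have := le_abs_self (θ (f x) * f x)
    have := neg_abs_le (θ 0 * f x)
    have := le_abs_self (∫ y in a..(0 : ℝ), θ y)
    have := neg_abs_le (∫ y in a..(0 : ℝ), θ y)
    have := abs_nonneg (θ (f x) * f x)
    have := abs_nonneg (θ 0 * f x)
    constructor <;> linarith

lemma primitiveFunctional_sub_le (hθ : Monotone θ) (hc : Continuous θ)
    (hN : ∀ f, N f =ᵐ[μ] fun x => θ (f x)) (a : ℝ) (f g : Lp ℝ 2 μ) :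
    primitiveFunctional θ a f - primitiveFunctional θ a g ≤ inner ℝ (N f) (f - g) := by
  rw [primitiveFunctional, primitiveFunctional, ← integral_sub (integrable_primitive hθ hc hN a f)
    (integrable_primitive hθ hc hN a g), L2.inner_def]
  refine integral_mono_ae ((integrable_primitive hθ hc hN a f).sub
    (integrable_primitive hθ hc hN a g)) (L2.integrable_inner _ _) ?_
  filter_upwards [hN f, Lp.coeFn_sub f g] with x h1 h2
  rw [h1, h2, Pi.sub_apply, intervalIntegral.integral_interval_sub_left
    (hc.intervalIntegrable _ _) (hc.intervalIntegrable _ _)]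
  refine (integral_le_mul_sub_of_monotone hθ hc _ _).trans_eq ?_
  simp [mul_comm]

/-- The subgradient inequalities at f and at g squeeze the difference of values between two pairings
with f - g, which vanish as f → g because N is continuous. -/
lemma continuous_primitiveFunctional (hθ : Monotone θ) (hc : Continuous θ)
    (hN : ∀ f, N f =ᵐ[μ] fun x => θ (f x)) (hNc : Continuous N) (a : ℝ) :
    Continuous (primitiveFunctional (μ := μ) θ a) := by
  rw [continuous_iff_continuousAt]
  intro g
  rw [ContinuousAt, ← tendsto_sub_nhds_zero_iff]
  have h1 : Tendsto (fun f => inner ℝ (N f) (f - g)) (𝓝 g) (𝓝 0) := by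
    have : Continuous fun f => inner ℝ (N f) (f - g) := by fun_prop
    simpa using this.tendsto g
  have h2 : Tendsto (fun f => inner ℝ (N g) (f - g)) (𝓝 g) (𝓝 0) := by
    have : Continuous fun f => inner ℝ (N g) (f - g) := by fun_prop
    simpa using this.tendsto g
  refine tendsto_of_tendsto_of_tendsto_of_le_of_le h2 h1 (fun f => ?_)
    (fun f => primitiveFunctional_sub_le hθ hc hN a f g)
  have := primitiveFunctional_sub_le hθ hc hN a g f
  rw [← neg_sub f g, inner_neg_right] at this
  simp only
  linarith

end ConvexFunctional

/-! ### Energy inequality for derivatives in a dual space. -/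

section AbstractEnergy

lemma memLp_two_indicator_Ioc {F : Type*} [NormedAddCommGroup F] {T : ℝ} {f : ℝ → F}
    (hf : MemLp f 2 (timeMeasure T)) :
    MemLp (indicator (Ioc 0 T) f) 2 volume ∧ Integrable (indicator (Ioc 0 T) f) volume :=
  ⟨(memLp_indicator_iff_restrict measurableSet_Ioc).2 hf,
    (integrable_indicator_iff measurableSet_Ioc).2 (hf.integrable (by norm_num))⟩

variable {V X : Type*} [NormedAddCommGroup V] [NormedSpace ℝ V]
  [NormedAddCommGroup X] [InnerProductSpace ℝ X]

/-- The energy inequality for a convex functional `E` with subgradient `N` along a curve `c` whose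
derivative `D` takes values in the dual of a space `V` embedded by `j`. -/
theorem convex_sub_le_integral {T : ℝ} (hT : 0 < T) (j : V →L[ℝ] X) {c : ℝ → X}
    (hc : ContinuousOn c (Icc 0 T)) {D : ℝ → StrongDual ℝ V} (hD : MemLp D 2 (timeMeasure T))
    (hcD : ∀ t ∈ Icc 0 T, ∀ φ, inner ℝ (c t) (j φ) = inner ℝ (c 0) (j φ) + ∫ s in (0 : ℝ)..t, D s φ)
    {E : X → ℝ} (hE : Continuous E) {N : X → X} (hN : ∀ f g, E f - E g ≤ inner ℝ (N f) (f - g))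
    {w : ℝ → V} (hw : MemLp w 2 (timeMeasure T))
    (hwN : ∀ᵐ t ∂timeMeasure T, j (w t) = N (c t)) {s : ℝ} (hs : s ∈ Ioc 0 T) :
    E (c s) - E (c 0) ≤ ∫ t in Ioc 0 s, D t (w t) := by
  set D' := indicator (Ioc 0 T) D with hD'
  obtain ⟨hD2, hD1⟩ : MemLp D' 2 volume ∧ Integrable D' volume := memLp_two_indicator_Ioc hD
  -- Backward increments reach t - h < 0, so the curve is frozen at its initial value there,
  -- consistently with D extended by zero.
  set e : ℝ → X := IccExtend hT.le ((Icc 0 T).domRestrict c) with he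
  have hec : Continuous e := (continuousOn_iff_continuous_domRestrict.1 hc).Icc_extend'
  have he_of : ∀ t ∈ Icc 0 T, e t = c t := fun t ht => IccExtend_of_mem hT.le _ ht
  have he_neg : ∀ t ≤ 0, e t = c 0 := fun t ht => IccExtend_of_le_left hT.le _ ht
  have hsub : Ioc 0 s ⊆ Ioc 0 T := Ioc_subset_Ioc_right hs.2
  have hmono : volume.restrict (Ioc 0 s) ≤ timeMeasure T := Measure.restrict_mono hsub le_rfl
  have hDi : ∀ a b, IntervalIntegrable D' volume a b := fun a b => hD1.intervalIntegrable
  have hprim : ∀ t ≤ T, ∀ φ, inner ℝ (e t) (j φ) =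
      inner ℝ (c 0) (j φ) + (∫ r in (0 : ℝ)..t, D' r) φ := by
    intro t ht φ
    rcases le_or_gt t 0 with h0 | h0
    · rw [he_neg t h0, intervalIntegral.integral_symm, intervalIntegral.integral_of_le h0,
        setIntegral_eq_zero_of_forall_eq_zero]
      · simp
      · intro r hr
        exact indicator_of_notMem (fun h => not_lt.2 hr.2 h.1) _
    · rw [he_of t ⟨h0.le, ht⟩, hcD t ⟨h0.le, ht⟩, ContinuousLinearMap.intervalIntegral_apply (hDi _ _)]
      have e1 : ∫ r in (0 : ℝ)..t, D' r φ = ∫ r in (0 : ℝ)..t, D r φ := by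
        rw [intervalIntegral.integral_of_le h0.le, intervalIntegral.integral_of_le h0.le]
        refine setIntegral_congr_fun measurableSet_Ioc fun r hr => ?_
        have hrT : r ∈ Ioc 0 T := ⟨hr.1, hr.2.trans ht⟩
        simp only [hD', indicator_of_mem hrT]
      rw [e1]
  have key := sub_le_integral_pairing (E := fun t => E (e t)) (hE.comp hec) hD2 hD1 hs.1
    (hw.mono_measure hmono) (w := w) (by
      filter_upwards [ae_mono hmono hwN, ae_restrict_mem measurableSet_Ioc] with t h1 h2 h h0 _
      have htT : t ∈ Icc 0 T := ⟨h2.1.le, h2.2.trans hs.2⟩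
      refine (hN _ _).trans_eq ?_
      rw [he_of t htT, ← h1, real_inner_comm, inner_sub_left, ← he_of t htT, hprim t htT.2,
        hprim (t - h) (by linarith [htT.2]),
        ← intervalIntegral.integral_interval_sub_left (hDi 0 t) (hDi 0 (t - h)),
        sub_apply]
      ring)
  simp only [he_of s ⟨hs.1.le, hs.2⟩, he_neg 0 le_rfl] at key
  refine key.trans_eq (setIntegral_congr_fun measurableSet_Ioc fun t ht => ?_)
  simp [hD', hsub ht]

end AbstractEnergy

/-! ### Curves whose derivative is the sum of an X part and a dual part. -/

section Evolution

variable {V X : Type*} [NormedAddCommGroup V] [NormedSpace ℝ V]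
  [NormedAddCommGroup X] [InnerProductSpace ℝ X]

lemma inner_eq_add_integral_of_weak_deriv [CompleteSpace X] {T : ℝ} (hT : 0 < T) {c : ℝ → X}
    (hc : ContinuousOn c (Icc 0 T)) {dv : ℝ → X} (hi : Integrable dv (timeMeasure T))
    (h : ∀ η, IsTimeTest T η →
      ∫ t in Ioc 0 T, deriv η t • c t = -∫ t in Ioc 0 T, η t • dv t)
    (x : X) {t : ℝ} (ht : t ∈ Icc 0 T) :
    inner ℝ (c t) x = inner ℝ (c 0) x + ∫ s in (0 : ℝ)..t, inner ℝ (dv s) x := by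
  refine eq_add_integral_of_weak_deriv hT (f := fun t => inner ℝ (c t) x)
    (hc.inner continuousOn_const) (hi.inner_const x) (fun η hη => ?_) t ht
  have hic : Integrable c (timeMeasure T) :=
    hc.integrableOn_Icc.mono_set Ioc_subset_Icc_self
  have hbd : ∀ ζ : ℝ → ℝ, Continuous ζ → HasCompactSupport ζ → ∀ y : ℝ → X,
      Integrable y (timeMeasure T) → Integrable (fun t => ζ t • y t) (timeMeasure T) := by
    intro ζ h1 h2 y hy
    obtain ⟨C, hC⟩ := h1.bounded_above_of_compact_support h2
    exact hy.bdd_smul C h1.aestronglyMeasurable (Eventually.of_forall hC)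
  have e := congrArg (fun y => inner ℝ x y) (h η hη)
  simp only [inner_neg_right] at e
  rw [← integral_inner (hbd _ (hη.1.continuous_deriv (by simp)) hη.2.1.deriv _ hic) x,
    ← integral_inner (hbd _ hη.1.continuous hη.2.1 _ hi) x] at e
  simp only [inner_smul_right] at e
  simp only [real_inner_comm]
  exact e

lemma MeasureTheory.MemLp.integrable_inner {α : Type*} {m : MeasurableSpace α} {μ : Measure α}
    {f g : α → X} (hf : MemLp f 2 μ) (hg : MemLp g 2 μ) :
    Integrable (fun t => (inner ℝ (f t) (g t) : ℝ)) μ :=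
  memLp_one_iff_integrable.1 ((innerSL ℝ).memLp_of_bilin 1 hf hg)

/-- The energy inequality for `c = cv - cS`, when the derivative of `cv` takes values in `X` and
the derivative of `cS` takes values in the dual of `V`. -/
theorem convex_sub_le_integral_sub_integral [CompleteSpace X] {T : ℝ} (hT : 0 < T) (j : V →L[ℝ] X)
    {cv cS : ℝ → X} (hcv : ContinuousOn cv (Icc 0 T)) (hcS : ContinuousOn cS (Icc 0 T))
    {dv : ℝ → X} (hdv : MemLp dv 2 (timeMeasure T)) {dS : ℝ → StrongDual ℝ V}
    (hdS : MemLp dS 2 (timeMeasure T))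
    (hv : ∀ η, IsTimeTest T η →
      ∫ t in Ioc 0 T, deriv η t • cv t = -∫ t in Ioc 0 T, η t • dv t)
    (S₀ : X)
    (hS : ∀ η, IsTimeTest T η → ∀ φ,
      ∫ t in Ioc 0 T, deriv η t * inner ℝ (cS t - S₀) (j φ) = -∫ t in Ioc 0 T, η t * dS t φ)
    {E : X → ℝ} (hE : Continuous E) {N : X → X} (hN : ∀ f g, E f - E g ≤ inner ℝ (N f) (f - g))
    {w : ℝ → V} (hw : MemLp w 2 (timeMeasure T))
    (hwN : ∀ᵐ t ∂timeMeasure T, j (w t) = N (cv t - cS t)) {s : ℝ} (hs : s ∈ Ioc 0 T) :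
    E (cv s - cS s) - E (cv 0 - cS 0) ≤
      (∫ t in Ioc 0 s, inner ℝ (dv t) (j (w t))) - ∫ t in Ioc 0 s, dS t (w t) := by
  have hmono : volume.restrict (Ioc 0 s) ≤ timeMeasure T :=
    Measure.restrict_mono (Ioc_subset_Ioc_right hs.2) le_rfl
  have hdSi : Integrable dS (timeMeasure T) := hdS.integrable (by norm_num)
  have hdvi : Integrable dv (timeMeasure T) := hdv.integrable (by norm_num)
  -- J embeds X into the dual of V as in the triple H¹₀ ⊂ L² ⊂ H⁻¹, so that cv - cS has the single
  -- derivative J(dv) - dS.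
  let J : X →L[ℝ] StrongDual ℝ V := (ContinuousLinearMap.compL ℝ V X ℝ).flip j ∘L innerSL ℝ
  have hJ : ∀ x φ, J x φ = inner ℝ x (j φ) := fun _ _ => rfl
  have hD : MemLp (fun t => J (dv t) - dS t) 2 (timeMeasure T) := (J.comp_memLp' hdv).sub hdS
  have hDS : ∀ t ∈ Icc 0 T, ∀ φ,
      inner ℝ (cS t) (j φ) = inner ℝ (cS 0) (j φ) + ∫ s in (0 : ℝ)..t, dS s φ := by
    intro t ht φ
    have := eq_add_integral_of_weak_deriv hT (f := fun t => inner ℝ (cS t - S₀) (j φ))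
      ((hcS.sub continuousOn_const).inner continuousOn_const) (hdSi.apply_continuousLinearMap φ)
      (fun η hη => hS η hη φ) t ht
    simp only [inner_sub_left] at this
    linarith
  have hcD : ∀ t ∈ Icc 0 T, ∀ φ, inner ℝ (cv t - cS t) (j φ) =
      inner ℝ (cv 0 - cS 0) (j φ) + ∫ s in (0 : ℝ)..t, (J (dv s) - dS s) φ := by
    intro t ht φ
    have h1 := inner_eq_add_integral_of_weak_deriv hT hcv hdvi hv (j φ) ht
    have h2 := hDS t ht φ
    have hsub : Ioc 0 t ⊆ Ioc 0 T := Ioc_subset_Ioc_right ht.2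
    have i1 : IntegrableOn (fun s => inner ℝ (dv s) (j φ)) (Ioc 0 t) :=
      IntegrableOn.mono_set (hdvi.inner_const (j φ)) hsub
    have i2 : IntegrableOn (fun s => dS s φ) (Ioc 0 t) :=
      IntegrableOn.mono_set (hdSi.apply_continuousLinearMap φ) hsub
    have e : ∫ s in (0 : ℝ)..t, (J (dv s) - dS s) φ =
        (∫ s in (0 : ℝ)..t, inner ℝ (dv s) (j φ)) - ∫ s in (0 : ℝ)..t, dS s φ := by
      simp only [intervalIntegral.integral_of_le ht.1]
      rw [← integral_sub i1 i2]
      rfl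
    rw [e, inner_sub_left, inner_sub_left, h1, h2]
    ring
  have key := convex_sub_le_integral hT j (hcv.sub hcS) hD hcD hE hN hw hwN hs
  have i1 : Integrable (fun t => inner ℝ (dv t) (j (w t))) (volume.restrict (Ioc 0 s)) :=
    (hdv.mono_measure hmono).integrable_inner ((j.comp_memLp' hw).mono_measure hmono)
  have i2 : Integrable (fun t => dS t (w t)) (volume.restrict (Ioc 0 s)) :=
    memLp_one_iff_integrable.1 ((ContinuousLinearMap.id ℝ (StrongDual ℝ V)).memLp_of_bilin
      1 (hdS.mono_measure hmono) (hw.mono_measure hmono))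
  rw [← integral_sub i1 i2]
  exact key

end Evolution

/-! ### The entropy inequality. -/

section Entropy

variable {d : ℕ} {Ω : Set (EPHSpace d)} {T : ℝ}

lemma BoundedC1.memLp_compH10 {β : ℝ → ℝ} {M : ℝ} (h : BoundedC1 β M) (p : L2Time T (H10 Ω)) :
    MemLp (fun t => h.compH10 (p t)) 2 (timeMeasure T) :=
  (Lp.memLp p).of_le_mul (c := M)
    (h.continuous_compH10.comp_aestronglyMeasurable (Lp.aestronglyMeasurable p))
    (Eventually.of_forall fun _ => h.norm_compH10_le _)

/-- Testing an identity in `L²(0,T)` with the restriction of `w` to `(0,s)`. -/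
lemma setIntegral_toLp_indicator {F : Type} [NormedAddCommGroup F] {w : ℝ → F} {s : ℝ}
    (hs : s ∈ Ioc 0 T) (hw : MemLp (indicator (Ioc 0 s) w) 2 (timeMeasure T)) {f : ℝ → F → ℝ}
    (hf : ∀ t, f t 0 = 0) :
    ∫ t in Ioc 0 T, f t (hw.toLp _ t) = ∫ t in Ioc 0 s, f t (w t) := by
  have hsub : Ioc 0 s ⊆ Ioc 0 T := Ioc_subset_Ioc_right hs.2
  have e : (fun t => f t (hw.toLp _ t)) =ᵐ[timeMeasure T] indicator (Ioc 0 s) fun t => f t (w t) := by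
    filter_upwards [hw.coeFn_toLp] with t ht
    rw [ht]
    by_cases hts : t ∈ Ioc 0 s
    · simp [hts]
    · simp [hts, hf]
  rw [integral_congr_ae e, setIntegral_indicator measurableSet_Ioc, inter_eq_self_of_subset_right hsub]

lemma setIntegral_weak_form {k : ℝ → ℝ} {g : EPHSpace d} {S : L2Time T (EPHL2 Ω)}
    {p : L2Time T (H10 Ω)} {dS : L2Time T (HMinus1 Ω)}
    (hweak : ∀ φ : L2Time T (H10 Ω), ∫ t in Ioc 0 T, (dS t) (φ t)
      = ∫ t in Ioc 0 T, ∫ x in Ω,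
          inner ℝ (k (S t x) • (H10.grad (p t) x - g)) (H10.grad (φ t) x))
    {w : ℝ → H10 Ω} (hwm : MemLp w 2 (timeMeasure T)) {s : ℝ} (hs : s ∈ Ioc 0 T) :
    ∫ t in Ioc 0 s, dS t (w t) = ∫ t in Ioc 0 s, ∫ x in Ω,
      inner ℝ (k (S t x) • (H10.grad (p t) x - g)) (H10.grad (w t) x) := by
  have hφ : MemLp (indicator (Ioc 0 s) w) 2 (timeMeasure T) := hwm.indicator measurableSet_Ioc
  have := hweak (hφ.toLp _)
  rw [setIntegral_toLp_indicator hs hφ (f := fun t φ => dS t φ) (fun t => map_zero _),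
    setIntegral_toLp_indicator hs hφ (f := fun t φ => ∫ x in Ω,
      inner ℝ (k (S t x) • (H10.grad (p t) x - g)) (H10.grad φ x)) ?_] at this
  · exact this
  · intro t
    have h0 : H10.grad (0 : H10 Ω) = 0 := rfl
    rw [h0]
    refine integral_eq_zero_of_ae ?_
    filter_upwards [Lp.coeFn_zero (EPHSpace d) 2 (volume.restrict Ω)] with x hx
    rw [hx]; simp

/-- The test function ψ(u) - ψ(ρ_d(v)), cut off to (0,s), makes the right side of the second
equation pointwise nonpositive; no size information on 1/τ survives. -/
lemma setIntegral_inner_nonpos {pcI pcD b : ℝ → ℝ} (hpc : CapillaryCurves pcI pcD)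
    (hb : ScanningFunction pcI pcD b) {τ : ℝ} (hτ : 0 < τ) {p : L2Time T (H10 Ω)}
    {v dv : L2Time T (EPHL2 Ω)}
    (hode : ∀ ξ : L2Time T (EPHL2 Ω), ∫ t in Ioc 0 T, ∫ x in Ω, dv t x * ξ t x
      = ∫ t in Ioc 0 T, ∫ x in Ω,
          PhiTau pcI pcD b τ (b (H10.fn (p t) x)) (v t x) * ξ t x)
    {ψ : ℝ → ℝ} (hψm : Monotone ψ) {w : ℝ → H10 Ω} (hwm : MemLp w 2 (timeMeasure T))
    (hfnw : ∀ t, ∀ᵐ x ∂volume.restrict Ω, H10.fn (w t) x = ψ (b (H10.fn (p t) x)))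
    {r : ℝ → EPHL2 Ω} (hrm : MemLp r 2 (timeMeasure T))
    (hr : ∀ t, ∀ᵐ x ∂volume.restrict Ω, r t x = ψ (rho b pcD (v t x))) {s : ℝ}
    (hs : s ∈ Ioc 0 T) :
    ∫ t in Ioc 0 s, inner ℝ (dv t) (H10.fn (w t) - r t) ≤ 0 := by
  set ζ : ℝ → EPHL2 Ω := fun t => H10.fn (w t) - r t with hζ
  have hζm : MemLp ζ 2 (timeMeasure T) := ((H10.fnL Ω).comp_memLp' hwm).sub hrm
  have hξ : MemLp (indicator (Ioc 0 s) ζ) 2 (timeMeasure T) := hζm.indicator measurableSet_Ioc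
  have h0 : ∀ F : EPHSpace d → ℝ, ∫ x in Ω, F x * (0 : EPHL2 Ω) x = 0 := by
    intro F
    refine integral_eq_zero_of_ae ?_
    filter_upwards [Lp.coeFn_zero ℝ 2 (volume.restrict Ω)] with x hx
    rw [hx]; simp
  have := hode (hξ.toLp _)
  rw [setIntegral_toLp_indicator hs hξ (f := fun t ξ => ∫ x in Ω, dv t x * ξ x) fun t => h0 _,
    setIntegral_toLp_indicator hs hξ (f := fun t ξ => ∫ x in Ω,
      PhiTau pcI pcD b τ (b (H10.fn (p t) x)) (v t x) * ξ x) fun t => h0 _] at this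
  have e : ∀ t, inner ℝ (dv t) (ζ t) = ∫ x in Ω, dv t x * ζ t x := by
    intro t
    rw [L2.inner_def]
    refine integral_congr_ae (Eventually.of_forall fun x => ?_)
    exact mul_comm _ _
  change ∫ t in Ioc 0 s, inner ℝ (dv t) (ζ t) ≤ 0
  rw [integral_congr_ae (Eventually.of_forall e), this]
  refine integral_nonpos fun t => integral_nonpos_of_ae ?_
  filter_upwards [hfnw t, hr t,
    Lp.coeFn_sub (H10.fn (w t)) (r t)] with x h1 h2 h3
  rw [hζ]
  simp only
  rw [h3, Pi.sub_apply, h1, h2]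
  exact PhiTau_mul_nonpos hpc hb hψm hτ _ _

variable [IsFiniteMeasure (volume.restrict Ω)]

lemma memLp_bddComp {θ : ℝ → ℝ} {C : ℝ} (hθ : Continuous θ) (hC : ∀ x, |θ x| ≤ C)
    (v : L2Time T (EPHL2 Ω)) : MemLp (fun t => bddComp hθ hC (v t)) 2 (timeMeasure T) :=
  MemLp.of_bound
    ((continuous_bddComp hθ hC).comp_aestronglyMeasurable (Lp.aestronglyMeasurable v)) _
    (Eventually.of_forall fun _ => norm_bddCompSmul_le hθ hC _ _)

variable {pcI pcD k b : ℝ → ℝ} {g : EPHSpace d} {S₀ : EPHL2 Ω} {p₀ : H10 Ω} {τ M : ℝ}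
  {S : L2Time T (EPHL2 Ω)} {p : L2Time T (H10 Ω)}

/-- The entropy inequality for weak solutions. -/
theorem entropy_inequality (hT : 0 < T) (hpc : CapillaryCurves pcI pcD)
    (hb : ScanningFunction pcI pcD b) (hM : BoundedC1 b M) (hτ : 0 < τ)
    (h : IsEPHWeakSolution pcI pcD k b g S₀ p₀ τ S p) :
    ∃ cS cu : ℝ → EPHL2 Ω, (∀ᵐ t ∂timeMeasure T, cS t = S t) ∧
      (∀ᵐ t ∂timeMeasure T, cu t = hM.compL2 (H10.fn (p t))) ∧
      ∀ (ψ : ℝ → ℝ) (hψ : BoundedC1 ψ 1), Monotone ψ → ∀ (a : ℝ), ∀ s ∈ Ioc 0 T,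
        primitiveFunctional ψ 0 (cu s) - primitiveFunctional ψ 0 (hM.compL2 (H10.fn p₀))
          + ∫ t in Ioc 0 s, ∫ x in Ω, inner ℝ (k (S t x) • (H10.grad (p t) x - g))
              (H10.grad ((hψ.comp hM).compH10 (p t)) x)
          ≤ primitiveFunctional (fun y => ψ (rho b pcD y)) a (cS s + cu s)
            - primitiveFunctional (fun y => ψ (rho b pcD y)) a (S₀ + hM.compL2 (H10.fn p₀)) := by
  obtain ⟨-, ⟨cp, hcp, hcpp, hcp0⟩, ⟨cS, hcS, hcSS, hcS0⟩, -, ⟨Z, dS, hZ, hdS, hweak⟩,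
    ⟨v, dv, hv, hdv, hode⟩⟩ := h
  -- The continuous representative of u comes from that of p, since composition with the Lipschitz
  -- function b is continuous on L².
  set cu : ℝ → EPHL2 Ω := fun t => hM.compL2 (cp t) with hcu
  have hcuc : ContinuousOn cu (Icc 0 T) := hM.continuous_compL2.comp_continuousOn hcp
  have hcup : ∀ᵐ t ∂timeMeasure T, cu t = hM.compL2 (H10.fn (p t)) := by
    filter_upwards [hcpp] with t ht
    rw [hcu]; simp only [ht]
  refine ⟨cS, cu, hcSS, hcup, fun ψ hψ hψm a s hs => ?_⟩
  set cv : ℝ → EPHL2 Ω := fun t => cS t + cu t with hcv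
  have hcvc : ContinuousOn cv (Icc 0 T) := hcS.add hcuc
  have hcvv : ∀ᵐ t ∂timeMeasure T, cv t = v t := by
    filter_upwards [hcSS, hcup, hv] with t h1 h2 h3
    simp only [hcv]
    rw [h1, h2]
    apply Lp.ext
    filter_upwards [h3, Lp.coeFn_add (S t) (hM.compL2 (H10.fn (p t))), hM.coeFn_compL2 (H10.fn (p t))]
      with x a1 a2 a3
    rw [a2, Pi.add_apply, a3, a1]
  have hdvm : MemLp dv 2 (timeMeasure T) := Lp.memLp dv
  have hvw : ∀ η, IsTimeTest T η →
      ∫ t in Ioc 0 T, deriv η t • cv t = -∫ t in Ioc 0 T, η t • dv t := by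
    intro η hη
    rw [← hdv η hη]
    refine integral_congr_ae ?_
    filter_upwards [hcvv] with t ht
    rw [ht]
  set w : ℝ → H10 Ω := fun t => (hψ.comp hM).compH10 (p t) with hw
  have hwm : MemLp w 2 (timeMeasure T) := (hψ.comp hM).memLp_compH10 p
  have hfnw : ∀ t, ∀ᵐ x ∂volume.restrict Ω, H10.fn (w t) x = ψ (b (H10.fn (p t) x)) :=
    fun t => (hψ.comp hM).coeFn_compL2 (H10.fn (p t))
  -- the energy of `u`
  have energyU : primitiveFunctional ψ 0 (cu s) - primitiveFunctional ψ 0 (cu 0) ≤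
      (∫ t in Ioc 0 s, inner ℝ (dv t) (H10.fn (w t))) - ∫ t in Ioc 0 s, dS t (w t) := by
    have e : ∀ t, cv t - cS t = cu t := fun t => by simp only [hcv]; abel
    have := convex_sub_le_integral_sub_integral hT (H10.fnL Ω) hcvc hcS hdvm (Lp.memLp dS) hvw S₀
      (fun η hη φ => by
        rw [← hdS η hη φ]
        refine integral_congr_ae ?_
        filter_upwards [hZ, hcSS] with t h1 h2
        rw [h2, h1, H10.fnL_apply])
      (continuous_primitiveFunctional hψm hψ.contDiff.continuous hψ.coeFn_compL2
        hψ.continuous_compL2 0)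
      (primitiveFunctional_sub_le hψm hψ.contDiff.continuous hψ.coeFn_compL2 0) hwm (by
        filter_upwards [hcup] with t ht
        rw [e, ht, H10.fnL_apply]
        apply Lp.ext
        filter_upwards [hfnw t, hψ.coeFn_compL2 (hM.compL2 (H10.fn (p t))),
          hM.coeFn_compL2 (H10.fn (p t))] with x h1 h2 h3
        rw [h1, h2, h3]) hs
    rw [e, e] at this
    exact this
  -- the energy of `v`
  have hD := hb.curveD hpc
  set θ : ℝ → ℝ := fun y => ψ (rho b pcD y) with hθ
  have hθc : Continuous θ := hψ.contDiff.continuous.comp hD.rho_continuous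
  have hθb : ∀ y, |θ y| ≤ |b (pcD 1)| + |bInfty b| := fun y =>
    (hψ.abs_le _).trans (by rw [one_mul]; exact hD.abs_rho_le y)
  -- ψ∘ρ_d is nonincreasing, so -∫R is convex. The upper energy inequality for -∫R is the needed
  -- lower bound on the increment of ∫R(v).
  have hθm : Monotone fun y => -θ y := fun y z hyz => neg_le_neg (hψm (hD.rho_antitone hyz))
  have energyV : (∫ t in Ioc 0 s, inner ℝ (dv t) (bddComp hθc hθb (v t))) ≤
      primitiveFunctional θ a (cv s) - primitiveFunctional θ a (cv 0) := by
    have hN : ∀ f : EPHL2 Ω, (-bddComp hθc hθb f : EPHL2 Ω) =ᵐ[volume.restrict Ω]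
        fun x => -θ (f x) := by
      intro f
      filter_upwards [Lp.coeFn_neg (bddComp hθc hθb f), coeFn_bddComp hθc hθb f] with x h1 h2
      rw [h1, Pi.neg_apply, h2]
    have hmem : MemLp (fun t => -bddComp hθc hθb (v t)) 2 (timeMeasure T) :=
      (memLp_bddComp hθc hθb v).neg
    have := convex_sub_le_integral hT (ContinuousLinearMap.id ℝ (EPHL2 Ω)) hcvc
      (D := fun t => innerSL ℝ (dv t)) ((innerSL ℝ).comp_memLp' hdvm)
      (fun t ht x => inner_eq_add_integral_of_weak_deriv hT hcvc (hdvm.integrable (by norm_num))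
        hvw x ht)
      (continuous_primitiveFunctional hθm hθc.neg hN (continuous_bddComp hθc hθb).neg a)
      (primitiveFunctional_sub_le hθm hθc.neg hN a) hmem (by
        filter_upwards [hcvv] with t ht
        rw [ht]; rfl) hs
    rw [primitiveFunctional_neg, primitiveFunctional_neg] at this
    simp only [innerSL_apply_apply, inner_neg_right, integral_neg] at this
    linarith
  have weakS := setIntegral_weak_form hweak hwm hs
  have dissip := setIntegral_inner_nonpos hpc hb hτ hode hψm hwm hfnw
    (memLp_bddComp hθc hθb v) (fun t => coeFn_bddComp hθc hθb (v t)) hs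
  have hmono : volume.restrict (Ioc 0 s) ≤ timeMeasure T :=
    Measure.restrict_mono (Ioc_subset_Ioc_right hs.2) le_rfl
  have i1 : Integrable (fun t => inner ℝ (dv t) (H10.fn (w t))) (volume.restrict (Ioc 0 s)) :=
    (hdvm.integrable_inner ((H10.fnL Ω).comp_memLp' hwm)).mono_measure hmono
  have i2 : Integrable (fun t => inner ℝ (dv t) (bddComp hθc hθb (v t)))
      (volume.restrict (Ioc 0 s)) :=
    (hdvm.integrable_inner (memLp_bddComp hθc hθb v)).mono_measure hmono
  simp only [inner_sub_right] at dissip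
  rw [integral_sub i1 i2] at dissip
  have e0 : cu 0 = hM.compL2 (H10.fn p₀) := by simp only [hcu, hcp0]
  have e1 : cv 0 = S₀ + hM.compL2 (H10.fn p₀) := by simp only [hcv, e0, hcS0]
  rw [e0] at energyU
  rw [e1] at energyV
  rw [weakS] at energyU
  linarith

end Entropy

/-! ### Bounds on the permeability and a truncation function. -/

lemma Permeability.zero_lt_one {k : ℝ → ℝ} (hk : Permeability k) : k 0 < k 1 :=
  (hk.between (1 / 2) (by norm_num)).1.trans (hk.between (1 / 2) (by norm_num)).2

lemma Permeability.mem_Icc {k : ℝ → ℝ} (hk : Permeability k) (S : ℝ) : k S ∈ Icc (k 0) (k 1) := by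
  rcases le_or_gt S 0 with h | h
  · rw [hk.left S h]; exact ⟨le_rfl, hk.zero_lt_one.le⟩
  rcases le_or_gt 1 S with h' | h'
  · rw [hk.right S h']; exact ⟨hk.zero_lt_one.le, le_rfl⟩
  · exact ⟨(hk.between S ⟨h, h'⟩).1.le, (hk.between S ⟨h, h'⟩).2.le⟩

lemma Permeability.abs_le {k : ℝ → ℝ} (hk : Permeability k) (S : ℝ) : |k S| ≤ k 1 := by
  rw [abs_of_nonneg (hk.nonneg.trans (hk.mem_Icc S).1)]
  exact (hk.mem_Icc S).2

lemma Permeability.exists_pos_le {k : ℝ → ℝ} (hk : Permeability k) {s : ℝ} (hs : s ∈ Ioo (0 : ℝ) 1) :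
    ∃ κ > 0, ∀ S ∈ Icc s 1, κ ≤ k S := by
  obtain ⟨x, hx, hmin⟩ := isCompact_Icc.exists_isMinOn (nonempty_Icc.2 hs.2.le)
    hk.contDiff.continuous.continuousOn
  refine ⟨k x, ?_, fun S hS => hmin hS⟩
  rcases hx.2.eq_or_lt with h | h
  · rw [h]; exact hk.nonneg.trans_lt hk.zero_lt_one
  · exact hk.nonneg.trans_lt (hk.between x ⟨hs.1.trans_le hx.1, h⟩).1

lemma integral_eq_zero_of_le {f : ℝ → ℝ} {K a x : ℝ} (h0 : ∀ y ≤ K, f y = 0) (ha : a ≤ K)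
    (hx : x ≤ K) : ∫ y in a..x, f y = 0 := by
  refine intervalIntegral.integral_zero_ae (Eventually.of_forall fun y hy => h0 y ?_)
  rcases mem_uIoc.1 hy with h | h <;> linarith [h.2]

lemma integral_pos_of_lt {f : ℝ → ℝ} (hf : Continuous f) {K a x : ℝ} (h0 : ∀ y ≤ K, f y = 0)
    (h1 : ∀ y, K < y → 0 < f y) (ha : a ≤ K) (hx : K < x) : 0 < ∫ y in a..x, f y := by
  rw [← intervalIntegral.integral_add_adjacent_intervals (hf.intervalIntegrable a K)
    (hf.intervalIntegrable K x), integral_eq_zero_of_le h0 ha le_rfl, zero_add]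
  exact intervalIntegral.intervalIntegral_pos_of_pos_on (hf.intervalIntegrable K x)
    (fun y hy => h1 y hy.1) hx

/-- There are monotone functions with derivative in `[0,1]` that are positive exactly
on `(K, ∞)`. -/
lemma exists_truncation {K : ℝ} (hK : 0 ≤ K) : ∃ ψ : ℝ → ℝ, BoundedC1 ψ 1 ∧ Monotone ψ ∧
    (∀ x ≤ K, ψ x = 0) ∧ ∀ x, K < x → 0 < ψ x := by
  -- The derivative of ψ is a ramp from 0 at K to 1 at K + 1; K ≥ 0 makes the primitive based at 0
  -- vanish up to K.
  set f : ℝ → ℝ := fun y => max 0 (min (y - K) 1) with hf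
  have hfc : Continuous f := by fun_prop
  have hf0 : ∀ y ≤ K, f y = 0 := fun y hy =>
    max_eq_left ((min_le_left _ _).trans (by linarith))
  have hf1 : ∀ y, K < y → 0 < f y := fun y hy =>
    lt_max_of_lt_right (lt_min (by linarith) one_pos)
  have hnn : ∀ y, 0 ≤ f y := fun y => le_max_left _ _
  refine ⟨fun x => ∫ y in (0 : ℝ)..x, f y, BoundedC1.of_integral hfc fun y => ?_, ?_,
    fun x hx => integral_eq_zero_of_le hf0 hK hx, fun x hx => integral_pos_of_lt hfc hf0 hf1 hK hx⟩
  · rw [abs_of_nonneg (hnn y)]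
    exact max_le zero_le_one (min_le_right _ _)
  · intro x y hxy
    have := intervalIntegral.integral_interval_sub_left (hfc.intervalIntegrable (μ := volume) 0 y)
      (hfc.intervalIntegrable 0 x)
    have h2 := intervalIntegral.integral_nonneg (μ := volume) hxy fun z _ => hnn z
    simp only
    linarith

/-! ### Positive lower bounds for the saturation and the permeability. -/

section LowerBound

variable {d : ℕ} {Ω : Set (EPHSpace d)} {T : ℝ} [IsFiniteMeasure (volume.restrict Ω)]
  {pcI pcD k b : ℝ → ℝ} {g : EPHSpace d} {S₀ : EPHL2 Ω} {p₀ : H10 Ω} {M : ℝ}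

/-- Without gravity the saturation stays away from zero. -/
theorem exists_saturation_lower_bound (hT : 0 < T) (hpc : CapillaryCurves pcI pcD)
    (hk : Permeability k) (hb : ScanningFunction pcI pcD b) (hM : BoundedC1 b M)
    (hini : InitialData pcI pcD S₀ p₀) :
    ∃ s ∈ Ioo (0 : ℝ) 1, ∀ τ : ℝ, 0 < τ → ∀ (S : L2Time T (EPHL2 Ω)) (p : L2Time T (H10 Ω)),
      IsEPHWeakSolution pcI pcD k b 0 S₀ p₀ τ S p →
      ∀ᵐ t ∂timeMeasure T, ∀ᵐ x ∂volume.restrict Ω, s ≤ S t x := by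
  have hD := hb.curveD hpc
  have hI := hb.curveI hpc
  obtain ⟨ε, hε, hεS⟩ := hini.away
  -- The cap 1/2 keeps the level below 1 even if Ω is empty, when the bounds on S₀ say nothing about
  -- ε.
  have hε' : min ε (1 / 2) ∈ Ioo (0 : ℝ) 1 :=
    ⟨lt_min hε (by norm_num), (min_le_right _ _).trans_lt (by norm_num)⟩
  obtain ⟨s, hs, hsε, hps, hsv⟩ := exists_lower_saturation hpc hb hε'
  refine ⟨s, hs, fun τ hτ S p h => ?_⟩
  set K := b (pcD s) with hK
  have hK0 : 0 ≤ K := by rw [hK, ← hb.zero]; exact hD.monotone hps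
  obtain ⟨ψ, hψ, hψm, hψ0, hψ1⟩ := exists_truncation hK0
  obtain ⟨cS, cu, hcS, hcu, hent⟩ := entropy_inequality hT hpc hb hM hτ h
  set θ : ℝ → ℝ := fun y => ψ (rho b pcD y) with hθ
  have hψc := hψ.contDiff.continuous
  have hθc : Continuous θ := hψc.comp hD.rho_continuous
  have hθb : ∀ y, |θ y| ≤ |b (pcD 1)| + |bInfty b| := fun y =>
    (hψ.abs_le _).trans (by rw [one_mul]; exact hD.abs_rho_le y)
  have hθm : Monotone fun y => -θ y := fun y z hyz => neg_le_neg (hψm (hD.rho_antitone hyz))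
  have hθN : ∀ f : EPHL2 Ω, (-bddComp hθc hθb f : EPHL2 Ω) =ᵐ[volume.restrict Ω]
      fun x => -θ (f x) := by
    intro f
    filter_upwards [Lp.coeFn_neg (bddComp hθc hθb f), coeFn_bddComp hθc hθb f] with x h1 h2
    rw [h1, Pi.neg_apply, h2]
  -- primitives of `ψ` and of `θ`
  have hψnn : ∀ x, 0 ≤ ψ x := fun x => (le_or_gt x K).elim (fun h => (hψ0 x h).ge)
    fun h => (hψ1 x h).le
  have hΨ0 : ∀ x ≤ K, ∫ y in (0 : ℝ)..x, ψ y = 0 := fun x hx => integral_eq_zero_of_le hψ0 hK0 hx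
  have hΨ1 : ∀ x, K < x → 0 < ∫ y in (0 : ℝ)..x, ψ y := fun x hx =>
    integral_pos_of_lt hψc hψ0 hψ1 hK0 hx
  have hΨnn : ∀ x, 0 ≤ ∫ y in (0 : ℝ)..x, ψ y := fun x => (le_or_gt x K).elim
    (fun h => (hΨ0 x h).ge) fun h => (hΨ1 x h).le
  -- The base point s + K is the value of v at which ρ_d equals K, the threshold of ψ: beyond it
  -- ψ∘ρ_d vanishes, before it ψ∘ρ_d is positive.
  have hR0 : ∀ x, s + K ≤ x → ∫ y in (s + K)..x, -θ y = 0 := by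
    intro x hx
    refine intervalIntegral.integral_zero_ae (Eventually.of_forall fun y hy => ?_)
    rw [uIoc_of_le hx] at hy
    rw [hθ, neg_eq_zero]
    exact hψ0 _ (hD.rho_le_of_ge hs hy.1.le)
  have hR1 : ∀ x, x < s + K → 0 < ∫ y in (s + K)..x, -θ y := by
    intro x hx
    rw [intervalIntegral.integral_symm, intervalIntegral.integral_neg, neg_neg]
    refine intervalIntegral.intervalIntegral_pos_of_pos_on (hθc.intervalIntegrable _ _)
      (fun y hy => ?_) hx
    exact hψ1 _ (hD.lt_rho_of_lt hs hy.2)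
  have hRnn : ∀ x, 0 ≤ ∫ y in (s + K)..x, -θ y := fun x => (le_or_gt (s + K) x).elim
    (fun h => (hR0 x h).ge) fun h => (hR1 x h).le
  -- the initial values
  have hinit : ∀ᵐ x ∂volume.restrict Ω, b (H10.fn p₀ x) ≤ K ∧
      s + K ≤ S₀ x + b (H10.fn p₀ x) := by
    filter_upwards [hεS, hini.between] with x h1 h2
    have m1 : min ε (1 / 2) ≤ S₀ x := (min_le_left _ _).trans h1.1
    have m2 : S₀ x ≤ 1 := by linarith [h1.2]
    have mS : S₀ x ∈ Ioc (0 : ℝ) 1 := ⟨hε'.1.trans_le m1, m2⟩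
    constructor
    · exact hD.monotone (h2.2.trans (hD.pc_strictAntiOn.antitoneOn ⟨hs.1, hs.2.le⟩ mS (hsε.trans m1)))
    · have m3 : min ε (1 / 2) + b (pcI (min ε (1 / 2))) ≤ S₀ x + b (pcI (S₀ x)) :=
        hI.strictMonoOn.monotoneOn ⟨hε'.1, hε'.2.le⟩ mS m1
      have := hI.monotone h2.1
      linarith
  have hU0 : primitiveFunctional ψ 0 (hM.compL2 (H10.fn p₀)) = 0 := by
    refine integral_eq_zero_of_ae ?_
    filter_upwards [hinit, hM.coeFn_compL2 (H10.fn p₀)] with x h1 h2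
    rw [h2]; exact hΨ0 _ h1.1
  have hV0 : primitiveFunctional (fun y => -θ y) (s + K) (S₀ + hM.compL2 (H10.fn p₀)) = 0 := by
    refine integral_eq_zero_of_ae ?_
    filter_upwards [hinit, hM.coeFn_compL2 (H10.fn p₀), Lp.coeFn_add S₀ (hM.compL2 (H10.fn p₀))]
      with x h1 h2 h3
    rw [h3, Pi.add_apply, h2]; exact hR0 _ h1.2
  filter_upwards [hcS, ae_restrict_mem measurableSet_Ioc] with t ht htT
  have hent := hent ψ hψ hψm (s + K) t htT
  have hdiss : 0 ≤ ∫ t in Ioc 0 t, ∫ x in Ω, inner ℝ (k (S t x) • (H10.grad (p t) x - 0))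
      (H10.grad ((hψ.comp hM).compH10 (p t)) x) := by
    refine integral_nonneg fun r => integral_nonneg_of_ae ?_
    filter_upwards [(hψ.comp hM).coeFn_grad_compH10 (p r)] with x hx
    rw [hx, sub_zero, inner_smul_left, inner_smul_right, real_inner_self_eq_norm_sq]
    have h1 : 0 ≤ k (S r x) := hk.nonneg.trans (hk.mem_Icc _).1
    have h2 : 0 ≤ deriv (fun x => ψ (b x)) (H10.fn (p r) x) :=
      (hψm.comp hD.monotone).deriv_nonneg
    simp only [Pi.zero_apply, conj_trivial]
    positivity
  rw [hU0] at hent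
  have e1 := primitiveFunctional_neg θ (s + K) (S₀ + hM.compL2 (H10.fn p₀))
  have e2 := primitiveFunctional_neg θ (s + K) (cS t + cu t)
  rw [hV0] at e1
  have n1 : 0 ≤ primitiveFunctional ψ 0 (cu t) := integral_nonneg fun x => hΨnn _
  have n2 : 0 ≤ primitiveFunctional (fun y => -θ y) (s + K) (cS t + cu t) :=
    integral_nonneg fun x => hRnn _
  -- Two nonnegative quantities with nonpositive sum; vanishing of the integrals then gives u ≤ K
  -- and v ≥ s + K a.e.
  have z1 : primitiveFunctional ψ 0 (cu t) = 0 := by linarith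
  have z2 : primitiveFunctional (fun y => -θ y) (s + K) (cS t + cu t) = 0 := by linarith
  rw [primitiveFunctional, integral_eq_zero_iff_of_nonneg (fun x => hΨnn _)
    (integrable_primitive hψm hψc hψ.coeFn_compL2 0 (cu t))] at z1
  rw [primitiveFunctional, integral_eq_zero_iff_of_nonneg (fun x => hRnn _)
    (integrable_primitive hθm hθc.neg hθN (s + K) (cS t + cu t))] at z2
  filter_upwards [z1, z2, Lp.coeFn_add (cS t) (cu t)] with x h1 h2 h3
  rw [← ht]
  have u1 : cu t x ≤ K := by
    by_contra hcon
    exact (hΨ1 _ (not_le.1 hcon)).ne' h1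
  have u2 : s + K ≤ (cS t + cu t) x := by
    by_contra hcon
    exact (hR1 _ (not_le.1 hcon)).ne' h2
  rw [h3, Pi.add_apply] at u2
  linarith

/-- The permeability is bounded below along weak solutions. -/
theorem exists_permeability_lower_bound (hT : 0 < T) (hpc : CapillaryCurves pcI pcD)
    (hk : Permeability k) (hb : ScanningFunction pcI pcD b) (hM : BoundedC1 b M)
    (hini : InitialData pcI pcD S₀ p₀) (hcase : 0 < k 0 ∨ g = 0) :
    ∃ κ > 0, ∀ τ : ℝ, 0 < τ → ∀ (S : L2Time T (EPHL2 Ω)) (p : L2Time T (H10 Ω)),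
      IsEPHWeakSolution pcI pcD k b g S₀ p₀ τ S p →
      ∀ᵐ t ∂timeMeasure T, ∀ᵐ x ∂volume.restrict Ω, κ ≤ k (S t x) := by
  rcases hcase with h0 | rfl
  · exact ⟨k 0, h0, fun _ _ _ _ _ => Eventually.of_forall fun _ => Eventually.of_forall fun _ =>
      (hk.mem_Icc _).1⟩
  · obtain ⟨s, hs, hS⟩ := exists_saturation_lower_bound hT hpc hk hb hM hini
    obtain ⟨κ, hκ, hκS⟩ := hk.exists_pos_le hs
    refine ⟨κ, hκ, fun τ hτ S p h => ?_⟩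
    filter_upwards [hS τ hτ S p h, h.2.2.2.1] with t h1 h2
    filter_upwards [h1, h2] with x h3 h4
    exact hκS _ ⟨h3, h4.2⟩

end LowerBound

/-! ### Estimates uniform in the regularisation parameter. -/

lemma setIntegral_Ioc_le_of_ae_le {T : ℝ} (hT : 0 < T) {f : ℝ → ℝ}
    (hf : IntegrableOn f (Ioc 0 T)) {C : ℝ}
    (h : ∀ᵐ s ∂timeMeasure T, ∫ t in Ioc 0 s, f t ≤ C) : ∫ t in Ioc 0 T, f t ≤ C := by
  have hc : ContinuousOn (fun s => ∫ t in (0 : ℝ)..s, f t) (Icc 0 T) := by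
    have := intervalIntegral.continuousOn_primitive_interval (a := 0) (b := T) (f := f)
      (μ := volume) (by rw [uIcc_of_le hT.le, integrableOn_Icc_iff_integrableOn_Ioc]; exact hf)
    rwa [uIcc_of_le hT.le] at this
  -- The primitive and its minimum with C are continuous and agree a.e., hence everywhere, in
  -- particular at T.
  have hEq : EqOn (fun s => ∫ t in (0 : ℝ)..s, f t) (fun s => min (∫ t in (0 : ℝ)..s, f t) C)
      (Icc 0 T) := by
    refine Measure.eqOn_Icc_of_ae_eq volume hT.ne ?_ hc (hc.inf continuousOn_const)
    rw [← restrict_Ioc_eq_restrict_Icc]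
    filter_upwards [h, ae_restrict_mem measurableSet_Ioc] with s hs hsT
    rw [intervalIntegral.integral_of_le hsT.1.le, min_eq_left hs]
  have := hEq (right_mem_Icc.2 hT.le)
  simp only [intervalIntegral.integral_of_le hT.le] at this
  rw [this]
  exact min_le_right _ _

lemma BoundedC1.id : BoundedC1 (fun x : ℝ => x) 1 :=
  ⟨contDiff_id, rfl, fun x => by simp⟩

lemma primitiveFunctional_id {d : ℕ} {Ω : Set (EPHSpace d)} (f : EPHL2 Ω) :
    primitiveFunctional (fun x => x) 0 f = 1 / 2 * ‖f‖ ^ 2 := by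
  rw [primitiveFunctional, L2.norm_sq_eq_integral, ← integral_const_mul]
  refine integral_congr_ae (Eventually.of_forall fun x => ?_)
  simp only [integral_id, Real.norm_eq_abs, sq_abs]
  ring

/-- Because 0 ≤ β ≤ M, β|G|² ≥ |βG|²/M, so half of the quadratic term absorbs the gravity term by
completing the square. Only βG, the gradient of b(p), is controlled; β may vanish. -/
lemma dissipation_pointwise {d : ℕ} {κ M kk k₁ β : ℝ} (hκ : 0 < κ) (hM : 0 < M) (h1 : κ ≤ kk) (h2 : kk ≤ k₁)
    (h3 : 0 ≤ β) (h4 : β ≤ M) (G g : EPHSpace d) :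
    κ / (2 * M) * ‖β • G‖ ^ 2 - k₁ ^ 2 * ‖g‖ ^ 2 * M / (2 * κ) ≤ inner ℝ (kk • (G - g)) (β • G) := by
  rw [inner_smul_left, inner_smul_right, inner_sub_left, real_inner_self_eq_norm_sq, norm_smul,
    Real.norm_eq_abs, abs_of_nonneg h3, conj_trivial]
  have hcs := real_inner_le_norm g G
  set n := ‖g‖
  set N := ‖G‖
  have hn : 0 ≤ n := norm_nonneg _
  have hN : 0 ≤ N := norm_nonneg _
  have e1 : kk * (β * (n * N)) ≤ k₁ * (β * (n * N)) := by gcongr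
  have e2 : κ * (β * N ^ 2) ≤ kk * (β * N ^ 2) := by gcongr
  have e3 : κ / M * (β * N) ^ 2 ≤ κ * (β * N ^ 2) := by
    have : κ / M * (β * N) ^ 2 = κ * (β * N ^ 2) * (β / M) := by field_simp
    rw [this]
    exact mul_le_of_le_one_right (by positivity) ((div_le_one hM).2 h4)
  have e4 : 0 ≤ κ / (2 * M) * (β * N - k₁ * n * M / κ) ^ 2 := by positivity
  have e5 : κ / (2 * M) * (β * N - k₁ * n * M / κ) ^ 2 =
      κ / M * (β * N) ^ 2 - κ / (2 * M) * (β * N) ^ 2 - k₁ * (β * (n * N))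
        + k₁ ^ 2 * n ^ 2 * M / (2 * κ) := by
    field_simp
    ring
  have e6 : kk * (β * inner ℝ g G) ≤ kk * (β * (n * N)) := by
    have : 0 ≤ kk := hκ.le.trans h1
    gcongr
  linarith

section Apriori

variable {d : ℕ} {Ω : Set (EPHSpace d)} {T : ℝ} [IsFiniteMeasure (volume.restrict Ω)]
  {pcI pcD k b : ℝ → ℝ} {g : EPHSpace d} {S₀ : EPHL2 Ω} {p₀ : H10 Ω} {M κ : ℝ}

/-- The flux `k(S)(∇p - g)`. -/
def flux (hk : Permeability k) (g : EPHSpace d) (f : EPHL2 Ω) (G : EPHL2Vec Ω) : EPHL2Vec Ω :=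
  bddCompSmul hk.contDiff.continuous hk.abs_le f (G - Lp.const 2 _ g)

lemma coeFn_flux (hk : Permeability k) (f : EPHL2 Ω) (G : EPHL2Vec Ω) :
    ∀ᵐ x ∂volume.restrict Ω, flux hk g f G x = k (f x) • (G x - g) := by
  filter_upwards [coeFn_bddCompSmul hk.contDiff.continuous hk.abs_le f (G - Lp.const 2 _ g),
    Lp.coeFn_sub G (Lp.const 2 _ g), Lp.coeFn_const (μ := volume.restrict Ω) 2 g] with x h1 h2 h3
  rw [flux, h1, h2, Pi.sub_apply, h3]
  rfl

lemma inner_flux (hk : Permeability k) (f : EPHL2 Ω) (G U : EPHL2Vec Ω) :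
    ∫ x in Ω, inner ℝ (k (f x) • (G x - g)) (U x) = inner ℝ (flux hk g f G) U := by
  rw [L2.inner_def]
  refine integral_congr_ae ?_
  filter_upwards [coeFn_flux (g := g) hk f G] with x hx
  rw [hx]

lemma memLp_flux (hk : Permeability k) (S : L2Time T (EPHL2 Ω)) (p : L2Time T (H10 Ω)) :
    MemLp (fun t => flux hk g (S t) (H10.grad (p t))) 2 (timeMeasure T) := by
  have h1 : MemLp (fun t => H10.grad (p t) - Lp.const 2 _ g) 2 (timeMeasure T) :=
    ((H10.gradL Ω).comp_memLp' (Lp.memLp p)).sub (memLp_const _)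
  refine h1.of_le_mul (c := k 1) ?_ (Eventually.of_forall fun t => norm_bddCompSmul_le _ _ _ _)
  exact (continuous_bddCompSmul (E := EPHSpace d) hk.contDiff.continuous
    hk.abs_le).comp_aestronglyMeasurable ((Lp.aestronglyMeasurable S).prodMk h1.1)

lemma dissipation_lower_bound (hk : Permeability k) (hM : BoundedC1 b M) (hM0 : 0 < M)
    (hb0 : ∀ x, 0 ≤ deriv b x) (hκ : 0 < κ) {f : EPHL2 Ω}
    (hf : ∀ᵐ x ∂volume.restrict Ω, κ ≤ k (f x)) (w : H10 Ω) :
    κ / (2 * M) * ‖H10.grad (hM.compH10 w)‖ ^ 2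
        - k 1 ^ 2 * ‖g‖ ^ 2 * M / (2 * κ) * (volume.restrict Ω).real univ
      ≤ inner ℝ (flux hk g f (H10.grad w)) (H10.grad (hM.compH10 w)) := by
  rw [L2.inner_def, L2.norm_sq_eq_integral, ← integral_const_mul]
  have e : k 1 ^ 2 * ‖g‖ ^ 2 * M / (2 * κ) * (volume.restrict Ω).real univ =
      ∫ _, k 1 ^ 2 * ‖g‖ ^ 2 * M / (2 * κ) ∂volume.restrict Ω := by
    rw [integral_const, smul_eq_mul, mul_comm]
  have i1 : Integrable (fun x => κ / (2 * M) * ‖H10.grad (hM.compH10 w) x‖ ^ 2)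
    (volume.restrict Ω) := (L2.integrable_norm_sq _).const_mul _
  rw [e, ← integral_sub i1 (integrable_const _)]
  refine integral_mono_ae (i1.sub (integrable_const _)) (L2.integrable_inner _ _) ?_
  filter_upwards [hf, coeFn_flux (g := g) hk f (H10.grad w), hM.coeFn_grad_compH10 w] with x h1 h2 h3
  rw [h2, h3]
  exact dissipation_pointwise hκ hM0 h1 (hk.mem_Icc _).2 (hb0 _)
    ((le_abs_self _).trans (hM.bound _)) _ _

/-- The primitive is at most C(1 + |u|), and C|u| ≤ C² + u²/4; the factor 1/4 leaves room below the
kinetic term ½‖u‖². -/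
lemma primitiveFunctional_le_of_bounded {θ : ℝ → ℝ} {C : ℝ} (hC : ∀ x, |θ x| ≤ C)
    {f s u : EPHL2 Ω} (hf : f = s + u)
    (hs : ∀ᵐ x ∂volume.restrict Ω, 0 ≤ s x ∧ s x ≤ 1)
    (hi : Integrable (fun x => ∫ y in (0 : ℝ)..f x, θ y) (volume.restrict Ω)) :
    primitiveFunctional θ 0 f ≤ (C + C ^ 2) * (volume.restrict Ω).real univ + 1 / 4 * ‖u‖ ^ 2 := by
  have hC0 : 0 ≤ C := (abs_nonneg _).trans (hC 0)
  have e : (C + C ^ 2) * (volume.restrict Ω).real univ = ∫ _, (C + C ^ 2) ∂volume.restrict Ω := by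
    rw [integral_const, smul_eq_mul, mul_comm]
  have i1 : Integrable (fun x => 1 / 4 * ‖u x‖ ^ 2) (volume.restrict Ω) :=
    (L2.integrable_norm_sq _).const_mul _
  rw [e, L2.norm_sq_eq_integral, ← integral_const_mul, ← integral_add (integrable_const _) i1]
  refine integral_mono_ae hi ((integrable_const _).add i1) ?_
  filter_upwards [hs, Lp.coeFn_add s u] with x h1 h2
  have h3 : |∫ y in (0 : ℝ)..f x, θ y| ≤ C * |f x - 0| :=
    intervalIntegral.norm_integral_le_of_norm_le_const (f := θ) (a := 0) (b := f x) fun y _ => hC y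
  have h4 : |f x| ≤ 1 + |u x| := by
    rw [hf, h2, Pi.add_apply]
    refine (abs_add_le _ _).trans (add_le_add_left ?_ _)
    rw [abs_of_nonneg h1.1]; exact h1.2
  have h5 : C * |f x| ≤ C * (1 + |u x|) := by gcongr
  rw [sub_zero] at h3
  have h6 := le_abs_self (∫ y in (0 : ℝ)..f x, θ y)
  simp only [Real.norm_eq_abs]
  nlinarith [sq_nonneg (C - |u x| / 2)]

/-- The uniform estimate for `u = b(p)`. -/
theorem exists_uniform_bound (hT : 0 < T) (hpc : CapillaryCurves pcI pcD)
    (hk : Permeability k) (hb : ScanningFunction pcI pcD b) (hM : BoundedC1 b M) (hM0 : 0 < M)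
    (hini : InitialData pcI pcD S₀ p₀) (hcase : 0 < k 0 ∨ g = 0) :
    ∃ C : ℝ, 0 ≤ C ∧ ∀ τ : ℝ, 0 < τ → ∀ (S : L2Time T (EPHL2 Ω)) (p : L2Time T (H10 Ω)),
      IsEPHWeakSolution pcI pcD k b g S₀ p₀ τ S p →
      (∀ᵐ t ∂timeMeasure T, ‖H10.fn (hM.compH10 (p t))‖ ≤ C) ∧
        ‖(hM.memLp_compH10 p).toLp _‖ ≤ C := by
  obtain ⟨κ, hκ, hκS⟩ := exists_permeability_lower_bound (g := g) hT hpc hk hb hM hini hcase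
  have hD := hb.curveD hpc
  set μ := (volume.restrict Ω).real univ with hμ
  have hμ0 : 0 ≤ μ := measureReal_nonneg
  set Cρ := |b (pcD 1)| + |bInfty b| with hCρ
  set C₂ := k 1 ^ 2 * ‖g‖ ^ 2 * M / (2 * κ) with hC₂
  have hC₂0 : 0 ≤ C₂ := by positivity
  set R₀ := primitiveFunctional (fun y => rho b pcD y) 0 (S₀ + hM.compL2 (H10.fn p₀)) with hR₀
  -- A collects the initial energy, the gravity term up to time T, the constant part of ∫R(v) and
  -- the initial value of ∫R. All depend on the data only.
  set A := 1 / 2 * ‖hM.compL2 (H10.fn p₀)‖ ^ 2 + T * (C₂ * μ) + (Cρ + Cρ ^ 2) * μ + |R₀| with hA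
  have hA0 : 0 ≤ A := by positivity
  set c := κ / (2 * M) with hc
  have hc0 : 0 < c := by positivity
  have hC0 : 0 ≤ √(4 * A) + √(T * (4 * A) + A / c) := by positivity
  -- The first root bounds the L^∞(L²) norm, the second the L²(H¹₀) norm; their sum serves for both.
  refine ⟨√(4 * A) + √(T * (4 * A) + A / c), hC0, fun τ hτ S p h => ?_⟩
  obtain ⟨cS, cu, hcS, hcu, hent⟩ := entropy_inequality hT hpc hb hM hτ h
  have hθm : Monotone fun y => -rho b pcD y := fun y z hyz => neg_le_neg (hD.rho_antitone hyz)
  have hθN : ∀ f : EPHL2 Ω, (-bddComp hD.rho_continuous hD.abs_rho_le f : EPHL2 Ω)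
      =ᵐ[volume.restrict Ω] fun x => -rho b pcD (f x) := by
    intro f
    filter_upwards [Lp.coeFn_neg (bddComp hD.rho_continuous hD.abs_rho_le f),
      coeFn_bddComp hD.rho_continuous hD.abs_rho_le f] with x h1 h2
    rw [h1, Pi.neg_apply, h2]
  set U : ℝ → H10 Ω := fun t => hM.compH10 (p t) with hU
  have hUm : MemLp U 2 (timeMeasure T) := hM.memLp_compH10 p
  have hgradm : MemLp (fun t => H10.grad (U t)) 2 (timeMeasure T) := (H10.gradL Ω).comp_memLp' hUm
  set F : ℝ → ℝ := fun t => inner ℝ (flux hk g (S t) (H10.grad (p t))) (H10.grad (U t)) with hF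
  have hFi : Integrable F (timeMeasure T) := (memLp_flux hk S p).integrable_inner hgradm
  have hgi : Integrable (fun t => ‖H10.grad (U t)‖ ^ 2) (timeMeasure T) :=
    hgradm.integrable_norm_pow (by norm_num)
  have hest : ∀ᵐ s ∂timeMeasure T,
      1 / 4 * ‖H10.fn (U s)‖ ^ 2 + c * ∫ t in Ioc 0 s, ‖H10.grad (U t)‖ ^ 2 ≤ A := by
    filter_upwards [hcS, hcu, h.2.2.2.1, ae_restrict_mem measurableSet_Ioc] with s h1 h2 h3 hs
    -- The choice ψ = id gives the energy estimate for u itself.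
    have hent := hent _ BoundedC1.id (fun _ _ h => h) 0 s hs
    have hsub : Ioc 0 s ⊆ Ioc 0 T := Ioc_subset_Ioc_right hs.2
    have hmono : volume.restrict (Ioc 0 s) ≤ timeMeasure T := Measure.restrict_mono hsub le_rfl
    have eF : ∫ t in Ioc 0 s, ∫ x in Ω, inner ℝ (k (S t x) • (H10.grad (p t) x - g))
        (H10.grad ((BoundedC1.id.comp hM).compH10 (p t)) x) = ∫ t in Ioc 0 s, F t := by
      refine integral_congr_ae (Eventually.of_forall fun t => ?_)
      exact inner_flux hk _ _ _
    have hFlow : c * (∫ t in Ioc 0 s, ‖H10.grad (U t)‖ ^ 2) - T * (C₂ * μ) ≤ ∫ t in Ioc 0 s, F t := by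
      have i1 : Integrable (fun t => c * ‖H10.grad (U t)‖ ^ 2) (volume.restrict (Ioc 0 s)) :=
        (hgi.mono_measure hmono).const_mul c
      have m1 : ∫ t in Ioc 0 s, (c * ‖H10.grad (U t)‖ ^ 2 - C₂ * μ) ≤ ∫ t in Ioc 0 s, F t := by
        refine integral_mono_ae (i1.sub (integrable_const _)) (hFi.mono_measure hmono) ?_
        filter_upwards [ae_mono hmono (hκS τ hτ S p h)] with t ht
        exact dissipation_lower_bound hk hM hM0 hb.deriv_nonneg hκ ht (p t)
      rw [integral_sub i1 (integrable_const _), integral_const_mul, setIntegral_const, smul_eq_mul,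
        Measure.real, Real.volume_Ioc, sub_zero, ENNReal.toReal_ofReal hs.1.le] at m1
      have : s * (C₂ * μ) ≤ T * (C₂ * μ) := mul_le_mul_of_nonneg_right hs.2 (by positivity)
      linarith
    have hR : primitiveFunctional (fun y => rho b pcD y) 0 (cS s + cu s) ≤
        (Cρ + Cρ ^ 2) * μ + 1 / 4 * ‖cu s‖ ^ 2 := by
      refine primitiveFunctional_le_of_bounded hD.abs_rho_le rfl (by rw [h1]; exact h3) ?_
      have := (integrable_primitive hθm hD.rho_continuous.neg hθN 0 (cS s + cu s)).neg
      refine this.congr (Eventually.of_forall fun x => ?_)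
      simp
    rw [eF, primitiveFunctional_id, primitiveFunctional_id] at hent
    have e2 : cu s = H10.fn (U s) := h2
    rw [e2] at hent hR
    have := neg_abs_le R₀
    rw [hA]
    linarith
  have hfn : ∀ᵐ t ∂timeMeasure T, ‖H10.fn (U t)‖ ^ 2 ≤ 4 * A := by
    filter_upwards [hest] with s hs
    have : 0 ≤ c * ∫ t in Ioc 0 s, ‖H10.grad (U t)‖ ^ 2 :=
      mul_nonneg hc0.le (integral_nonneg fun t => by positivity)
    linarith
  have hgrad : ∫ t in Ioc 0 T, ‖H10.grad (U t)‖ ^ 2 ≤ A / c := by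
    refine setIntegral_Ioc_le_of_ae_le hT hgi ?_
    filter_upwards [hest] with s hs
    rw [le_div_iff₀ hc0]
    have : 0 ≤ 1 / 4 * ‖H10.fn (U s)‖ ^ 2 := by positivity
    linarith
  constructor
  · filter_upwards [hfn] with t ht
    have := Real.le_sqrt_of_sq_le ht
    have := Real.sqrt_nonneg (T * (4 * A) + A / c)
    exact le_add_of_le_of_nonneg ‹_› this
  · refine le_add_of_nonneg_of_le (Real.sqrt_nonneg _) (Real.le_sqrt_of_sq_le ?_)
    have hfnm : MemLp (fun t => H10.fn (U t)) 2 (timeMeasure T) := (H10.fnL Ω).comp_memLp' hUm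
    have hfi : Integrable (fun t => ‖H10.fn (U t)‖ ^ 2) (timeMeasure T) :=
      hfnm.integrable_norm_pow (by norm_num)
    have e : ‖(hM.memLp_compH10 p).toLp _‖ ^ 2 =
        (∫ t in Ioc 0 T, ‖H10.fn (U t)‖ ^ 2) + ∫ t in Ioc 0 T, ‖H10.grad (U t)‖ ^ 2 := by
      rw [L2.norm_sq_eq_integral, ← integral_add hfi hgi]
      refine integral_congr_ae ?_
      filter_upwards [(hM.memLp_compH10 p).coeFn_toLp] with t ht
      rw [ht, H10.norm_sq]
    have m1 : ∫ t in Ioc 0 T, ‖H10.fn (U t)‖ ^ 2 ≤ T * (4 * A) := by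
      have := integral_mono_ae hfi (integrable_const (4 * A)) hfn
      rwa [setIntegral_const, smul_eq_mul, Measure.real, Real.volume_Ioc, sub_zero,
        ENNReal.toReal_ofReal hT.le] at this
    rw [e]
    exact add_le_add m1 hgrad

end Apriori

/-! ### Weak compactness and stability of an essential bound. -/

section WeakCompactness

/-- Bounded sequences in a Hilbert space have weakly convergent subsequences. -/
theorem exists_weakly_tendsto_subseq {H : Type*} [NormedAddCommGroup H] [InnerProductSpace ℝ H]
    [CompleteSpace H] {x : ℕ → H} {C : ℝ} (hx : ∀ n, ‖x n‖ ≤ C) :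
    ∃ (u : H) (θ : ℕ → ℕ), StrictMono θ ∧
      ∀ f : StrongDual ℝ H, Tendsto (fun n => f (x (θ n))) atTop (𝓝 (f u)) := by
  -- The closed span of the sequence is separable, so balls of its dual are weak* sequentially
  -- compact; functionals on H are then restricted to it by Riesz.
  let K : Submodule ℝ H := (Submodule.span ℝ (range x)).topologicalClosure
  have hKc : IsClosed (K : Set H) := Submodule.isClosed_topologicalClosure _
  have hsep : TopologicalSpace.IsSeparable (K : Set H) :=
    ((countable_range x).isSeparable.span).closure
  have : TopologicalSpace.SeparableSpace K := hsep.separableSpace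
  have : CompleteSpace K := hKc.completeSpace_coe
  have hxK : ∀ n, x n ∈ K := fun n =>
    Submodule.le_topologicalClosure _ (Submodule.subset_span (mem_range_self n))
  let y : ℕ → K := fun n => ⟨x n, hxK n⟩
  let z : ℕ → WeakDual ℝ K := fun n => StrongDual.toWeakDual (InnerProductSpace.toDual ℝ K (y n))
  have hz : ∀ n, z n ∈ WeakDual.toStrongDual ⁻¹' Metric.closedBall (0 : StrongDual ℝ K) C := by
    intro n
    have h : ‖InnerProductSpace.toDual ℝ K (y n)‖ ≤ C := by
      rw [LinearIsometryEquiv.norm_map]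
      exact hx n
    exact mem_closedBall_zero_iff.2 h
  obtain ⟨ℓ, -, θ, hθ, hlim⟩ := WeakDual.isSeqCompact_closedBall ℝ K 0 C hz
  let u : K := (InnerProductSpace.toDual ℝ K).symm (WeakDual.toStrongDual ℓ)
  refine ⟨u, θ, hθ, fun f => ?_⟩
  let q : K := (InnerProductSpace.toDual ℝ K).symm (f.comp K.subtypeL)
  have hq : ∀ v : K, f v = inner ℝ v q := by
    intro v
    rw [real_inner_comm, InnerProductSpace.toDual_symm_apply]
    rfl
  have h1 : Tendsto (fun n => z (θ n) q) atTop (𝓝 (ℓ q)) :=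
    ((WeakDual.eval_continuous q).tendsto ℓ).comp hlim
  have h2 : ∀ n, z (θ n) q = f (x (θ n)) := fun n => (hq (y (θ n))).symm
  have h3 : ℓ q = f u := by
    rw [hq u, InnerProductSpace.toDual_symm_apply]
    rfl
  simp only [h2, h3] at h1
  exact h1

/-- An essential bound on `j ∘ w` is stable under weak convergence in `L²`. -/
theorem ae_norm_le_of_weakly_tendsto {α : Type*} {m : MeasurableSpace α} {μ : Measure α}
    [IsFiniteMeasure μ] {V X : Type*} [NormedAddCommGroup V] [NormedSpace ℝ V]
    [NormedAddCommGroup X] [InnerProductSpace ℝ X] (j : V →L[ℝ] X) {w : ℕ → Lp V 2 μ}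
    {u : Lp V 2 μ} {C : ℝ} (hC : 0 ≤ C) (hw : ∀ n, ∀ᵐ t ∂μ, ‖j (w n t)‖ ≤ C)
    (hlim : ∀ f : StrongDual ℝ (Lp V 2 μ), Tendsto (fun n => f (w n)) atTop (𝓝 (f u))) :
    ∀ᵐ t ∂μ, ‖j (u t)‖ ≤ C := by
  have hsm : StronglyMeasurable fun t => j (u t) :=
    j.continuous.comp_stronglyMeasurable (Lp.stronglyMeasurable u)
  -- Testing the weak convergence with 1_E j(u) gives ∫_E ‖j(u)‖² ≤ C ∫_E ‖j(u)‖, whereas the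
  -- opposite strict inequality holds pointwise on E; so E is null.
  set E := {t | C < ‖j (u t)‖} with hE
  have hEm : MeasurableSet E := measurableSet_lt measurable_const hsm.norm.measurable
  have hju : MemLp (fun t => j (u t)) 2 μ := j.comp_memLp' (Lp.memLp u)
  have hy : MemLp (indicator E fun t => j (u t)) 2 μ := hju.indicator hEm
  let f : StrongDual ℝ (Lp V 2 μ) := (innerSL ℝ (hy.toLp _)).comp (j.compLpL 2 μ)
  have hf : ∀ v : Lp V 2 μ, f v = ∫ t in E, inner ℝ (j (u t)) (j (v t)) ∂μ := by
    intro v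
    change inner ℝ (hy.toLp _) (j.compLpL 2 μ v) = _
    rw [L2.inner_def, ← integral_indicator hEm]
    refine integral_congr_ae ?_
    filter_upwards [hy.coeFn_toLp, j.coeFn_compLpL (p := 2) v] with t h1 h2
    rw [h1, h2]
    by_cases ht : t ∈ E <;> simp [ht]
  have hi : ∀ v : Lp V 2 μ, IntegrableOn (fun t => inner ℝ (j (u t)) (j (v t))) E μ := fun v =>
    (hju.integrable_inner (j.comp_memLp' (Lp.memLp v))).integrableOn
  have hn : IntegrableOn (fun t => C * ‖j (u t)‖) E μ :=
    ((hju.integrable (by norm_num)).norm.const_mul C).integrableOn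
  have hle : f u ≤ ∫ t in E, C * ‖j (u t)‖ ∂μ := by
    refine le_of_tendsto (hlim f) (Eventually.of_forall fun n => ?_)
    rw [hf]
    refine integral_mono_ae (hi _) hn ?_
    filter_upwards [ae_restrict_of_ae (hw n)] with t ht
    calc inner ℝ (j (u t)) (j (w n t)) ≤ ‖j (u t)‖ * ‖j (w n t)‖ := real_inner_le_norm _ _
      _ ≤ ‖j (u t)‖ * C := by gcongr
      _ = C * ‖j (u t)‖ := mul_comm _ _
  rw [hf] at hle
  have hpos : 0 ≤ᵐ[μ.restrict E] fun t => inner ℝ (j (u t)) (j (u t)) - C * ‖j (u t)‖ := by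
    filter_upwards [ae_restrict_mem hEm] with t ht
    have : C < ‖j (u t)‖ := ht
    simp only [Pi.zero_apply, real_inner_self_eq_norm_sq]
    nlinarith [norm_nonneg (j (u t))]
  have hzero : ∫ t in E, (inner ℝ (j (u t)) (j (u t)) - C * ‖j (u t)‖) ∂μ = 0 := by
    refine le_antisymm ?_ (integral_nonneg_of_ae hpos)
    rw [integral_sub (hi u) hn]
    linarith
  rw [integral_eq_zero_iff_of_nonneg_ae hpos ((hi u).sub hn), EventuallyEq,
    ae_restrict_iff' hEm] at hzero
  filter_upwards [hzero] with t ht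
  by_contra hcon
  have hlt : C < ‖j (u t)‖ := not_le.1 hcon
  have h0 := ht hlt
  simp only [Pi.zero_apply, real_inner_self_eq_norm_sq] at h0
  nlinarith

end WeakCompactness

/-! ### Identification of b(p) as an element of L²(0,T;H¹₀). -/

section Identification

variable {d : ℕ} {Ω : Set (EPHSpace d)} {T M : ℝ} {b : ℝ → ℝ}

instance H10.completeSpace : CompleteSpace (H10 Ω) :=
  (Submodule.isClosed_topologicalClosure _).completeSpace_coe

lemma isBOf_compH10 (hM : BoundedC1 b M) (p : L2Time T (H10 Ω)) :
    IsBOf b p ((hM.memLp_compH10 p).toLp _) := by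
  filter_upwards [(hM.memLp_compH10 p).coeFn_toLp] with t ht
  rw [ht]
  exact hM.coeFn_compL2 _

/-- `IsBOf` fixes only function values; injectivity of `H10.fn` fixes the gradients too, so the
bounds apply to every such u. -/
lemma IsBOf.eq_compH10 [IsFiniteMeasure (volume.restrict Ω)] (hΩ : IsOpen Ω)
    (hM : BoundedC1 b M) {p u : L2Time T (H10 Ω)} (h : IsBOf b p u) :
    u = (hM.memLp_compH10 p).toLp _ := by
  apply Lp.ext
  filter_upwards [h, (hM.memLp_compH10 p).coeFn_toLp] with t h1 h2
  rw [h2]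
  apply H10.fn_injective hΩ
  apply Lp.ext
  filter_upwards [h1, hM.coeFn_compL2 (H10.fn (p t))] with x h3 h4
  rw [h3, hM.fn_compH10, h4]

end Identification

end

theorem mainTheorem5 {d : ℕ} (hd : 0 < d) (Ω : Set (EPHSpace d)) (hΩ : IsOpen Ω)
    (hΩb : Bornology.IsBounded Ω) (T : ℝ) (hT : 0 < T)
    (pcI pcD k b : ℝ → ℝ) (g : EPHSpace d) (S₀ : EPHL2 Ω) (p₀ : H10 Ω)
    (hpc : CapillaryCurves pcI pcD) (hk : Permeability k) (hb : ScanningFunction pcI pcD b)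
    (hini : InitialData pcI pcD S₀ p₀) (hcase : 0 < k 0 ∨ g = 0) :
    (∃ C : ℝ, ∀ τ : ℝ, 0 < τ → ∀ (S : L2Time T (EPHL2 Ω)) (p : L2Time T (H10 Ω)),
      IsEPHWeakSolution pcI pcD k b g S₀ p₀ τ S p →
      ∃ u : L2Time T (H10 Ω), IsBOf b p u ∧ ‖u‖ ≤ C ∧
        eLpNorm (fun t => H10.fn (u t)) ∞ (timeMeasure T) ≤ ENNReal.ofReal C) ∧
    (∀ (τ : ℕ → ℝ) (S : ℕ → L2Time T (EPHL2 Ω)) (p uτ : ℕ → L2Time T (H10 Ω)),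
      (∀ n, 0 < τ n) → Tendsto τ atTop (𝓝 0) →
      (∀ n, IsEPHWeakSolution pcI pcD k b g S₀ p₀ (τ n) (S n) (p n)) →
      (∀ n, IsBOf b (p n) (uτ n)) →
      ∃ (u : L2Time T (H10 Ω)) (θ : ℕ → ℕ), StrictMono θ ∧
        MemLp (fun t => H10.fn (u t)) ∞ (timeMeasure T) ∧
        ∀ f : StrongDual ℝ (L2Time T (H10 Ω)),
          Tendsto (fun n => f (uτ (θ n))) atTop (𝓝 (f u))) := by
  have : IsFiniteMeasure (volume.restrict Ω) :=
    isFiniteMeasure_restrict.2 hΩb.measure_lt_top.ne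
  obtain ⟨bM, hbM⟩ := hb.deriv_bdd
  -- The maximum with 1 makes the slope bound strictly positive, as the dissipation estimate divides
  -- by it.
  have hM : BoundedC1 b (max bM 1) := by
    refine ⟨hb.contDiff, hb.zero, fun x => ?_⟩
    rw [abs_of_nonneg (hb.deriv_nonneg x)]
    exact (hbM x).trans (le_max_left _ _)
  have hM0 : 0 < max bM 1 := lt_max_of_lt_right one_pos
  obtain ⟨C, hC0, hC⟩ := exists_uniform_bound (g := g) hT hpc hk hb hM hM0 hini hcase
  refine ⟨⟨C, fun τ hτ S p h => ?_⟩, fun τ S p uτ hτ _ h hu => ?_⟩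
  · obtain ⟨h1, h2⟩ := hC τ hτ S p h
    refine ⟨_, isBOf_compH10 hM p, h2, ?_⟩
    rw [eLpNorm_exponent_top]
    refine eLpNormEssSup_le_of_ae_bound ?_
    filter_upwards [h1, (hM.memLp_compH10 p).coeFn_toLp] with t h3 h4
    rw [h4]
    exact h3
  · have hbound : ∀ n, ‖uτ n‖ ≤ C := fun n => by
      rw [(hu n).eq_compH10 hΩ hM]
      exact (hC (τ n) (hτ n) (S n) (p n) (h n)).2
    have hfn : ∀ n, ∀ᵐ t ∂timeMeasure T, ‖H10.fnL Ω (uτ n t)‖ ≤ C := fun n => by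
      rw [(hu n).eq_compH10 hΩ hM]
      filter_upwards [(hC (τ n) (hτ n) (S n) (p n) (h n)).1,
        (hM.memLp_compH10 (p n)).coeFn_toLp] with t h3 h4
      rw [h4]
      exact h3
    obtain ⟨u, θ, hθ, hlim⟩ := exists_weakly_tendsto_subseq (H := L2Time T (H10 Ω)) hbound
    refine ⟨u, θ, hθ, ?_, hlim⟩
    refine memLp_top_of_bound ((H10.fnL Ω).continuous.comp_aestronglyMeasurable
      (Lp.aestronglyMeasurable u)) C ?_
    exact ae_norm_le_of_weakly_tendsto (H10.fnL Ω) hC0 (fun n => hfn (θ n)) hlim
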